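/- Let $G$ be a hyperbolic group acting by graph automorphisms on a simplicial tree $T$ (not necessarily locally finite), and suppose that the action is cocompact, i.e. the $G$-translates of some finite subgraph cover $T$. For a vertex $v$ let $G_v$ be its stabilizer, and for an edge $e$ with ends $v,w$ let $G_e=G_v\cap G_w$ be its stabilizer (the pointwise stabilizer, which is the full stabilizer of $e$ if $G$ acts without inversions). Suppose that all the groups $G_v$ and $G_e$ are hyperbolic, and that for every edge $e$ and each end $v$ of $e$ the inclusion $G_e\hookrightarrow G_v$ is a quasi-isometric embedding with respect to word metrics of finite generating sets. Let $H$ be the stabilizer $G_v$ of a vertex or the stabilizer $G_e$ of an edge of $T$. Then a Cannon–Thurston map exists for $(H,G)$, that is: for every finite generating set $S$ of $H$ and every finite generating set $S'\supseteq S$ of $G$, with Cayley graphs $\Gamma_H$ and $\Gamma_G$ (geodesic metric spaces with edges of length $1$), the natural map $i:\Gamma_H\to\Gamma_G$ extends to a continuous map $\hat i:\Gamma_H\cup\partial\Gamma_H\to\Gamma_G\cup\partial\Gamma_G$ of the Gromov compactifications. Here a metric space $X$ is hyperbolic if there is $\delta$ with $(x,z)_w\ge\min\{(x,y)_w,(y,z)_w\}-\delta$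 for all $x,y,z,w\in X$, where $(a,b)_c=\tfrac12\big(d(a,c)+d(b,c)-d(a,b)\big)$, and a group is hyperbolic if its Cayley graph for some finite generating set is hyperbolic. The boundary $\partial X$ is the set of geodesic rays $[0,\infty)\to X$ from a base point $x_0$ (the vertex $1$ of a Cayley graph), two rays being identified if they stay at bounded distance from each other. In $X\cup\partial X$ a set $U$ is open if $U\cap X$ is open in $X$ and for each $\xi\in U\cap\partial X$ there is $R$ such that $U$ contains every $a\in X\cup\partial X$ for which $(r(t),s(t))_{x_0}>R$ for all large $t$, for some ray $r$ in the class $\xi$ and some $s$ that is a ray in the class $a$ (if $a\in\partial X$) or constant equal to $a$ (if $a\in X$). -/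

import Mathlib

open Filter Topology NNReal

section GeometricRealization

/-- A parametrized point of a graph all of whose edges have length one: either a vertex, written
`(v, v, 0)`, or the point at distance `pos` from `fst` on the edge from `fst` to `snd`. (Different
triples may name the same point; they are identified in `GeometricRealization`.) -/
structure EdgePoint {V : Type*} (Γ : SimpleGraph V) (hΓ : Γ.Connected) where
  /-- the first end -/
  fst : V
  /-- the second end -/
  snd : V
  /-- the distance from the first end -/
  pos : ℝ
  valid : (fst = snd ∧ pos = 0) ∨ (Γ.Adj fst snd ∧ 0 ≤ pos ∧ pos ≤ 1)

namespace EdgePoint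

variable {V : Type*} {Γ : SimpleGraph V} {hΓ : Γ.Connected}

lemma pos_nonneg (p : EdgePoint Γ hΓ) : 0 ≤ p.pos := by
  rcases p.valid with h | h
  · exact h.2.ge
  · exact h.2.1

lemma pos_le_one (p : EdgePoint Γ hΓ) : p.pos ≤ 1 := by
  rcases p.valid with h | h
  · rw [h.2]; norm_num
  · exact h.2.2

lemma dist_ends (p : EdgePoint Γ hΓ) : (Γ.dist p.fst p.snd : ℝ) ≤ 1 := by
  rcases p.valid with h | h
  · rw [h.1]; simp
  · rw [SimpleGraph.dist_eq_one_iff_adj.2 h.1]; simp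

lemma graph_triangle (hΓ : Γ.Connected) (u v w : V) :
    (Γ.dist u w : ℝ) ≤ Γ.dist u v + Γ.dist v w := by
  exact_mod_cast hΓ.dist_triangle

/-- The path distance from a point to a vertex: leave the edge through one of its two ends. -/
noncomputable def toVertex (p : EdgePoint Γ hΓ) (v : V) : ℝ :=
  min (p.pos + Γ.dist p.fst v) (1 - p.pos + Γ.dist p.snd v)

/-- The infimum of the lengths of the paths from `p` to `q` that leave the edge of `p` through one
of its two ends. -/
noncomputable def pathDist (p q : EdgePoint Γ hΓ) : ℝ :=
  min (p.pos + q.toVertex p.fst) (1 - p.pos + q.toVertex p.snd)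

open Classical in
/-- The path metric: the distance along the edge for two points of the same edge, and otherwise
the length of a shortest path through vertices. -/
noncomputable def distance (p q : EdgePoint Γ hΓ) : ℝ :=
  if p.fst = q.fst ∧ p.snd = q.snd then |p.pos - q.pos|
  else if p.fst = q.snd ∧ p.snd = q.fst then |p.pos - (1 - q.pos)|
  else pathDist p q

lemma toVertex_lipschitz (p : EdgePoint Γ hΓ) (v w : V) :
    p.toVertex v ≤ p.toVertex w + Γ.dist w v := by
  have h1 := graph_triangle hΓ p.fst w v
  have h2 := graph_triangle hΓ p.snd w v
  unfold toVertex
  rcases le_total (p.pos + Γ.dist p.fst w) (1 - p.pos + Γ.dist p.snd w) with h | h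
  · rw [min_eq_left h]; exact (min_le_left _ _).trans (by linarith)
  · rw [min_eq_right h]; exact (min_le_right _ _).trans (by linarith)

lemma dist_le_toVertex_add (p : EdgePoint Γ hΓ) (v w : V) :
    (Γ.dist v w : ℝ) ≤ p.toVertex v + p.toVertex w := by
  have h0 := p.pos_nonneg
  have h1 := p.pos_le_one
  have he := p.dist_ends
  have he' : (Γ.dist p.snd p.fst : ℝ) ≤ 1 := by rw [SimpleGraph.dist_comm]; exact he
  have a1 := graph_triangle hΓ v p.fst w
  have a2 := graph_triangle hΓ v p.snd w
  have a3 := graph_triangle hΓ p.fst p.snd w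
  have a4 := graph_triangle hΓ p.snd p.fst w
  rw [SimpleGraph.dist_comm (u := v) (v := p.fst)] at a1
  rw [SimpleGraph.dist_comm (u := v) (v := p.snd)] at a2
  unfold toVertex
  rcases min_choice (p.pos + (Γ.dist p.fst v : ℝ)) (1 - p.pos + Γ.dist p.snd v) with h | h <;>
  rcases min_choice (p.pos + (Γ.dist p.fst w : ℝ)) (1 - p.pos + Γ.dist p.snd w) with h' | h' <;>
  rw [h, h'] <;> linarith

lemma pathDist_le (p q : EdgePoint Γ hΓ) (v : V) :
    pathDist p q ≤ p.toVertex v + q.toVertex v := by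
  have h1 := q.toVertex_lipschitz p.fst v
  have h2 := q.toVertex_lipschitz p.snd v
  rw [SimpleGraph.dist_comm] at h1 h2
  unfold pathDist
  rcases min_choice (p.pos + (Γ.dist p.fst v : ℝ)) (1 - p.pos + Γ.dist p.snd v) with h | h
  · rw [show p.toVertex v = _ from h]; exact (min_le_left _ _).trans (by linarith)
  · rw [show p.toVertex v = _ from h]; exact (min_le_right _ _).trans (by linarith)

lemma exists_le_pathDist (p q : EdgePoint Γ hΓ) :
    ∃ v, p.toVertex v + q.toVertex v ≤ pathDist p q := by
  have h1 : p.toVertex p.fst ≤ p.pos := (min_le_left _ _).trans (by simp)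
  have h2 : p.toVertex p.snd ≤ 1 - p.pos := (min_le_right _ _).trans (by simp)
  unfold pathDist
  rcases min_choice (p.pos + q.toVertex p.fst) (1 - p.pos + q.toVertex p.snd) with h | h
  · exact ⟨p.fst, by rw [h]; linarith⟩
  · exact ⟨p.snd, by rw [h]; linarith⟩

lemma pathDist_comm (p q : EdgePoint Γ hΓ) : pathDist p q = pathDist q p := by
  obtain ⟨v, hv⟩ := exists_le_pathDist p q
  obtain ⟨w, hw⟩ := exists_le_pathDist q p
  have := pathDist_le q p v
  have := pathDist_le p q w
  linarith

lemma distance_comm (p q : EdgePoint Γ hΓ) : distance p q = distance q p := by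
  unfold distance
  by_cases h1 : p.fst = q.fst ∧ p.snd = q.snd
  · rw [if_pos h1, if_pos (And.intro h1.1.symm h1.2.symm), abs_sub_comm]
  · have h1' : ¬(q.fst = p.fst ∧ q.snd = p.snd) := fun h => h1 ⟨h.1.symm, h.2.symm⟩
    rw [if_neg h1, if_neg h1']
    by_cases h2 : p.fst = q.snd ∧ p.snd = q.fst
    · rw [if_pos h2, if_pos (And.intro h2.2.symm h2.1.symm), abs_sub_comm q.pos, ← abs_neg]
      congr 1; ring
    · have h2' : ¬(q.fst = p.snd ∧ q.snd = p.fst) := fun h => h2 ⟨h.2.symm, h.1.symm⟩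
      rw [if_neg h2, if_neg h2', pathDist_comm]

lemma pos_eq_zero (p : EdgePoint Γ hΓ) (h : p.fst = p.snd) : p.pos = 0 := by
  rcases p.valid with hv | hv
  · exact hv.2
  · exact absurd h hv.1.ne

lemma one_le_dist_ends (p : EdgePoint Γ hΓ) (h : p.fst ≠ p.snd) (v : V) :
    (1 : ℝ) ≤ Γ.dist p.fst v + Γ.dist p.snd v := by
  have key := graph_triangle hΓ p.fst v p.snd
  rw [SimpleGraph.dist_comm (u := v)] at key
  have h1 : (1 : ℝ) ≤ Γ.dist p.fst p.snd := by
    exact_mod_cast hΓ.pos_dist_of_ne h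
  linarith

lemma distance_le (p q : EdgePoint Γ hΓ) (v : V) :
    distance p q ≤ p.toVertex v + q.toVertex v := by
  have hp := p.pos_nonneg
  have hp' := p.pos_le_one
  have hq := q.pos_nonneg
  have hq' := q.pos_le_one
  have n1 : (0 : ℝ) ≤ Γ.dist p.fst v := Nat.cast_nonneg _
  have n2 : (0 : ℝ) ≤ Γ.dist p.snd v := Nat.cast_nonneg _
  unfold distance
  split_ifs with h1 h2
  · have key : (p.pos = 0 ∧ q.pos = 0) ∨ (1 : ℝ) ≤ Γ.dist p.fst v + Γ.dist p.snd v := by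
      by_cases h : p.fst = p.snd
      · exact Or.inl ⟨p.pos_eq_zero h, q.pos_eq_zero (by rw [← h1.1, ← h1.2, h])⟩
      · exact Or.inr (p.one_le_dist_ends h v)
    unfold toVertex
    rw [← h1.1, ← h1.2]
    rcases min_choice (p.pos + (Γ.dist p.fst v : ℝ)) (1 - p.pos + Γ.dist p.snd v) with h | h <;>
    rcases min_choice (q.pos + (Γ.dist p.fst v : ℝ)) (1 - q.pos + Γ.dist p.snd v) with h' | h' <;>
    rcases key with key | key <;>
    rw [h, h', abs_le] <;> constructor <;> linarith
  · have key := p.one_le_dist_ends (fun h => h1 ⟨h.trans h2.2, h.symm.trans h2.1⟩) v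
    unfold toVertex
    rw [← h2.1, ← h2.2]
    rcases min_choice (p.pos + (Γ.dist p.fst v : ℝ)) (1 - p.pos + Γ.dist p.snd v) with h | h <;>
    rcases min_choice (q.pos + (Γ.dist p.snd v : ℝ)) (1 - q.pos + Γ.dist p.fst v) with h' | h' <;>
    rw [h, h', abs_le] <;> constructor <;> linarith
  · exact pathDist_le p q v

lemma toVertex_le_distance_add (p q : EdgePoint Γ hΓ) (v : V) :
    p.toVertex v ≤ distance p q + q.toVertex v := by
  unfold distance
  split_ifs with h1 h2
  · unfold toVertex
    rw [← h1.1, ← h1.2]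
    have a1 := le_abs_self (p.pos - q.pos)
    have a2 := neg_abs_le (p.pos - q.pos)
    rcases min_choice (q.pos + (Γ.dist p.fst v : ℝ)) (1 - q.pos + Γ.dist p.snd v) with h | h
    · rw [h]; exact (min_le_left _ _).trans (by linarith)
    · rw [h]; exact (min_le_right _ _).trans (by linarith)
  · unfold toVertex
    rw [← h2.1, ← h2.2]
    have a1 := le_abs_self (p.pos - (1 - q.pos))
    have a2 := neg_abs_le (p.pos - (1 - q.pos))
    rcases min_choice (q.pos + (Γ.dist p.snd v : ℝ)) (1 - q.pos + Γ.dist p.fst v) with h | h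
    · rw [h]; exact (min_le_right _ _).trans (by linarith)
    · rw [h]; exact (min_le_left _ _).trans (by linarith)
  · obtain ⟨w, hw⟩ := exists_le_pathDist p q
    have h1 := p.toVertex_lipschitz v w
    have h2 := q.dist_le_toVertex_add w v
    linarith

lemma distance_eq (p q : EdgePoint Γ hΓ) :
    (p.fst = q.fst ∧ p.snd = q.snd ∧ distance p q = |p.pos - q.pos|) ∨
    (p.fst = q.snd ∧ p.snd = q.fst ∧ distance p q = |p.pos - (1 - q.pos)|) ∨
    distance p q = pathDist p q := by
  unfold distance
  split_ifs with h1 h2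
  · exact Or.inl ⟨h1.1, h1.2, rfl⟩
  · exact Or.inr (Or.inl ⟨h2.1, h2.2, rfl⟩)
  · exact Or.inr (Or.inr rfl)

lemma distance_le_of_eq (p q : EdgePoint Γ hΓ) (h1 : p.fst = q.fst) (h2 : p.snd = q.snd) :
    distance p q ≤ |p.pos - q.pos| := by
  rw [distance, if_pos ⟨h1, h2⟩]

lemma distance_le_of_swap (p q : EdgePoint Γ hΓ) (h1 : p.fst = q.snd) (h2 : p.snd = q.fst) :
    distance p q ≤ |p.pos - (1 - q.pos)| := by
  by_cases h : p.fst = q.fst ∧ p.snd = q.snd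
  · have hpq : p.fst = p.snd := h1.trans h.2.symm
    have hqq : q.fst = q.snd := h.1.symm.trans h1
    have e1 : p.pos = 0 := p.pos_eq_zero hpq
    have e2 : q.pos = 0 := q.pos_eq_zero hqq
    rw [distance, if_pos h, e1, e2]
    norm_num
  · rw [distance, if_neg h, if_pos ⟨h1, h2⟩]

lemma distance_triangle (p q r : EdgePoint Γ hΓ) :
    distance p r ≤ distance p q + distance q r := by
  have via : ∀ v, distance p r ≤ p.toVertex v + r.toVertex v := distance_le p r
  rcases distance_eq q r with ⟨b1, b2, b3⟩ | ⟨b1, b2, b3⟩ | b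
  · rcases distance_eq p q with ⟨a1, a2, a3⟩ | ⟨a1, a2, a3⟩ | a
    · refine (distance_le_of_eq p r (a1.trans b1) (a2.trans b2)).trans ?_
      rw [a3, b3]; exact abs_sub_le _ _ _
    · refine (distance_le_of_swap p r (a1.trans b2) (a2.trans b1)).trans ?_
      rw [a3, b3]
      refine (abs_sub_le _ (1 - q.pos) _).trans (le_of_eq ?_)
      rw [abs_sub_comm q.pos]; congr 2; ring
    · obtain ⟨w, hw⟩ := exists_le_pathDist p q
      have := toVertex_le_distance_add r q w
      rw [distance_comm r q] at this
      linarith [via w]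
  · rcases distance_eq p q with ⟨a1, a2, a3⟩ | ⟨a1, a2, a3⟩ | a
    · refine (distance_le_of_swap p r (a1.trans b1) (a2.trans b2)).trans ?_
      rw [a3, b3]; exact abs_sub_le _ _ _
    · refine (distance_le_of_eq p r (a1.trans b2) (a2.trans b1)).trans ?_
      rw [a3, b3]
      refine (abs_sub_le _ (1 - q.pos) _).trans (le_of_eq ?_)
      rw [abs_sub_comm q.pos]; congr 2; ring
    · obtain ⟨w, hw⟩ := exists_le_pathDist p q
      have := toVertex_le_distance_add r q w
      rw [distance_comm r q] at this
      linarith [via w]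
  · obtain ⟨w, hw⟩ := exists_le_pathDist q r
    have := toVertex_le_distance_add p q w
    linarith [via w]

noncomputable instance : PseudoMetricSpace (EdgePoint Γ hΓ) where
  dist := distance
  dist_self p := by simp [distance]
  dist_comm := distance_comm
  dist_triangle := distance_triangle

lemma dist_def (p q : EdgePoint Γ hΓ) : dist p q = distance p q := rfl

variable {W : Type*} {Δ : SimpleGraph W} {hΔ : Δ.Connected}

/-- The map on parametrized points induced by a graph homomorphism, linear on each edge. -/
def map (hΔ : Δ.Connected) (φ : Γ →g Δ) (p : EdgePoint Γ hΓ) : EdgePoint Δ hΔ where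
  fst := φ p.fst
  snd := φ p.snd
  pos := p.pos
  valid := p.valid.imp (fun h => ⟨congrArg φ h.1, h.2⟩) (fun h => ⟨φ.map_adj h.1, h.2⟩)

lemma graph_dist_map_le (hΓ : Γ.Connected) (φ : Γ →g Δ) (u v : V) :
    (Δ.dist (φ u) (φ v) : ℝ) ≤ Γ.dist u v := by
  obtain ⟨c, hc⟩ := hΓ.exists_walk_length_eq_dist u v
  have := SimpleGraph.dist_le (c.map φ)
  rw [SimpleGraph.Walk.length_map, hc] at this
  exact_mod_cast this

lemma toVertex_map_le (φ : Γ →g Δ) (p : EdgePoint Γ hΓ) (v : V) :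
    (p.map hΔ φ).toVertex (φ v) ≤ p.toVertex v := by
  have h1 := graph_dist_map_le hΓ φ p.fst v
  have h2 := graph_dist_map_le hΓ φ p.snd v
  unfold toVertex
  exact min_le_min (by simpa [map] using h1) (by simpa [map] using h2)

lemma dist_map_le (φ : Γ →g Δ) (p q : EdgePoint Γ hΓ) :
    dist (p.map hΔ φ) (q.map hΔ φ) ≤ dist p q := by
  rw [dist_def, dist_def]
  rcases distance_eq p q with ⟨a1, a2, a3⟩ | ⟨a1, a2, a3⟩ | a
  · rw [a3]; exact distance_le_of_eq _ _ (congrArg φ a1) (congrArg φ a2)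
  · rw [a3]; exact distance_le_of_swap _ _ (congrArg φ a1) (congrArg φ a2)
  · rw [a]
    obtain ⟨w, hw⟩ := exists_le_pathDist p q
    have h0 := distance_le (p.map hΔ φ) (q.map hΔ φ) (φ w)
    have h1 := toVertex_map_le (hΔ := hΔ) φ p w
    have h2 := toVertex_map_le (hΔ := hΔ) φ q w
    linarith

end EdgePoint

/-- The geometric realization of a connected graph, with its path metric for which every edge is
isometric to `[0, 1]`: parametrized points, identified when their distance is zero. -/
abbrev GeometricRealization {V : Type*} (Γ : SimpleGraph V) (hΓ : Γ.Connected) : Type _ :=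
  SeparationQuotient (EdgePoint Γ hΓ)

namespace GeometricRealization

variable {V W : Type*} {Γ : SimpleGraph V} {Δ : SimpleGraph W}

/-- A vertex of the graph as a point of the realization. -/
noncomputable def vertex (hΓ : Γ.Connected) (v : V) : GeometricRealization Γ hΓ :=
  SeparationQuotient.mk ⟨v, v, 0, Or.inl ⟨rfl, rfl⟩⟩

/-- The map of realizations induced by a graph homomorphism, linear on each edge. -/
noncomputable def map (hΓ : Γ.Connected) (hΔ : Δ.Connected) (φ : Γ →g Δ) :
    GeometricRealization Γ hΓ → GeometricRealization Δ hΔ :=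
  SeparationQuotient.lift (fun p => SeparationQuotient.mk (p.map hΔ φ)) fun p q hpq => by
    rw [SeparationQuotient.mk_eq_mk, Metric.inseparable_iff]
    exact le_antisymm ((EdgePoint.dist_map_le φ p q).trans (Metric.inseparable_iff.1 hpq).le)
      dist_nonneg

end GeometricRealization

end GeometricRealization

section GromovHyperbolic

/-- The Gromov product `(a, b)_c`. -/
noncomputable def gromovProduct {X : Type*} [MetricSpace X] (a b c : X) : ℝ :=
  (dist a c + dist b c - dist a b) / 2

/-- Hyperbolicity of a metric space in the sense of Gromov. -/
def IsGromovHyperbolic (X : Type*) [MetricSpace X] : Prop :=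
  ∃ δ : ℝ, ∀ x y z w : X,
    min (gromovProduct x y w) (gromovProduct y z w) - δ ≤ gromovProduct x z w

/-- Geodesic rays `[0, ∞) → X` starting at `x₀`. -/
structure GeodesicRay (X : Type*) [MetricSpace X] (x₀ : X) where
  /-- the underlying map -/
  toFun : ℝ≥0 → X
  isometry : Isometry toFun
  map_zero : toFun 0 = x₀

/-- Two rays are equivalent if they stay at bounded distance from each other. -/
def GeodesicRay.setoid (X : Type*) [MetricSpace X] (x₀ : X) : Setoid (GeodesicRay X x₀) where
  r r s := ∃ C : ℝ, ∀ t, dist (r.toFun t) (s.toFun t) ≤ C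
  iseqv :=
    { refl := fun r => ⟨0, fun t => by simp⟩
      symm := fun ⟨C, h⟩ => ⟨C, fun t => by rw [dist_comm]; exact h t⟩
      trans := fun ⟨C, h⟩ ⟨D, k⟩ =>
        ⟨C + D, fun t => (dist_triangle _ _ _).trans (add_le_add (h t) (k t))⟩ }

/-- The Gromov boundary `∂X`: equivalence classes of geodesic rays from the base point `x₀`. -/
def GromovBoundary (X : Type*) [MetricSpace X] (x₀ : X) : Type _ :=
  Quotient (GeodesicRay.setoid X x₀)

/-- The points of the Gromov compactification `X ∪ ∂X`. -/
inductive GromovCompactification (X : Type*) [MetricSpace X] (x₀ : X) : Type _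
  /-- a point of `X` -/
  | point (x : X) : GromovCompactification X x₀
  /-- a point of `∂X` -/
  | ideal (ξ : GromovBoundary X x₀) : GromovCompactification X x₀

namespace GromovCompactification

variable {X : Type*} [MetricSpace X] {x₀ : X}

/-- `Represents f a`: the path `f : [0, ∞) → X` is constant at `a` if `a` is a point of `X`, and it
is a geodesic ray from `x₀` in the class `a` if `a` is a point of `∂X`. -/
def Represents (f : ℝ≥0 → X) : GromovCompactification X x₀ → Prop
  | point x => f = fun _ => x
  | ideal ξ => ∃ r : GeodesicRay X x₀, Quotient.mk (GeodesicRay.setoid X x₀) r = ξ ∧ r.toFun = f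

/-- The basic neighbourhood of `ξ ∈ ∂X` of depth `R`: all `a ∈ X ∪ ∂X` such that for some
representatives `r` of `ξ` and `s` of `a` one has `(r(t), s(t))_{x₀} > R` for all large `t`. -/
def basicNhd (ξ : GromovBoundary X x₀) (R : ℝ) : Set (GromovCompactification X x₀) :=
  {a | ∃ r s : ℝ≥0 → X, Represents r (ideal ξ) ∧ Represents s a ∧
    ∀ᶠ t in atTop, R < gromovProduct (r t) (s t) x₀}

lemma basicNhd_anti (ξ : GromovBoundary X x₀) {R R' : ℝ} (h : R ≤ R') :
    basicNhd ξ R' ⊆ basicNhd ξ R := by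
  rintro a ⟨r, s, hr, hs, ht⟩
  exact ⟨r, s, hr, hs, ht.mono fun t => h.trans_lt⟩

/-- The usual topology on `X ∪ ∂X`: a set is open if its trace on `X` is open in `X` and it contains
a basic neighbourhood of each of its points in `∂X`. -/
instance : TopologicalSpace (GromovCompactification X x₀) where
  IsOpen U := IsOpen {x : X | point x ∈ U} ∧ ∀ ξ, ideal ξ ∈ U → ∃ R, basicNhd ξ R ⊆ U
  isOpen_univ := ⟨by simp, fun _ _ => ⟨0, Set.subset_univ _⟩⟩
  isOpen_inter U V hU hV := by
    refine ⟨hU.1.inter hV.1, fun ξ hξ => ?_⟩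
    obtain ⟨R, hR⟩ := hU.2 ξ hξ.1
    obtain ⟨R', hR'⟩ := hV.2 ξ hξ.2
    exact ⟨max R R', Set.subset_inter ((basicNhd_anti ξ (le_max_left _ _)).trans hR)
      ((basicNhd_anti ξ (le_max_right _ _)).trans hR')⟩
  isOpen_sUnion 𝒰 h𝒰 := by
    refine ⟨?_, ?_⟩
    · have : {x : X | (point x : GromovCompactification X x₀) ∈ ⋃₀ 𝒰} =
          ⋃ U ∈ 𝒰, {x : X | (point x : GromovCompactification X x₀) ∈ U} := by
        ext x; simp
      rw [this]
      exact isOpen_biUnion fun U hU => (h𝒰 U hU).1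
    · rintro ξ ⟨U, hU, hξ⟩
      obtain ⟨R, hR⟩ := (h𝒰 U hU).2 ξ hξ
      exact ⟨R, hR.trans (Set.subset_sUnion_of_mem hU)⟩

end GromovCompactification

end GromovHyperbolic

section Groups

variable {G : Type*} [Group G]

lemma mulCayley_connected {S : Set G} (hS : Subgroup.closure S = ⊤) :
    (SimpleGraph.mulCayley S).Connected := by
  have step : ∀ g s : G, s ∈ S → (SimpleGraph.mulCayley S).Reachable g (g * s) := by
    intro g s hs
    by_cases h : g = g * s
    · rw [← h]
    · exact SimpleGraph.Adj.reachable
        ((SimpleGraph.mulCayley_adj S _ _).2 ⟨h, Or.inl (by simpa using hs)⟩)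
  have key : ∀ x ∈ Subgroup.closure S, ∀ g : G,
      (SimpleGraph.mulCayley S).Reachable g (g * x) := by
    intro x hx
    induction hx using Subgroup.closure_induction with
    | mem x hx => exact fun g => step g x hx
    | one => intro g; rw [mul_one]
    | mul x y _ _ hx hy => intro g; rw [← mul_assoc]; exact (hx g).trans (hy (g * x))
    | inv x _ hx => intro g; simpa using (hx (g * x⁻¹)).symm
  refine (SimpleGraph.connected_iff _).2 ⟨fun u v => ?_, ⟨1⟩⟩
  have := key (u⁻¹ * v) (by rw [hS]; trivial) u
  simpa using this

/-- The Cayley graph of `G` with respect to a generating set `S`, as a geodesic metric space. -/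
abbrev CayleySpace (S : Set G) (hS : Subgroup.closure S = ⊤) : Type _ :=
  GeometricRealization (SimpleGraph.mulCayley S) (mulCayley_connected hS)

/-- The vertex `1` of the Cayley graph, used as base point. -/
noncomputable def CayleySpace.base (S : Set G) (hS : Subgroup.closure S = ⊤) : CayleySpace S hS :=
  GeometricRealization.vertex (mulCayley_connected hS) 1

/-- A group is hyperbolic if it has a finite generating set with hyperbolic Cayley graph. -/
def IsHyperbolicGroup (G : Type*) [Group G] : Prop :=
  ∃ (S : Set G) (hS : Subgroup.closure S = ⊤), S.Finite ∧ IsGromovHyperbolic (CayleySpace S hS)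

/-- The word metric on `G` with respect to a generating set `S`. -/
noncomputable def wordDist (S : Set G) (g h : G) : ℝ :=
  (SimpleGraph.mulCayley S).dist g h

/-- A homomorphism of finitely generated groups is a quasi-isometric embedding, with respect to word
metrics of finite generating sets (the choice of these does not matter). -/
def IsQuasiIsometricEmbedding {A B : Type*} [Group A] [Group B] (f : A →* B) : Prop :=
  ∃ (S : Set A) (T : Set B), S.Finite ∧ T.Finite ∧
    Subgroup.closure S = ⊤ ∧ Subgroup.closure T = ⊤ ∧
    ∃ K ε : ℝ, 1 ≤ K ∧ 0 ≤ ε ∧ ∀ x y : A,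
      1 / K * wordDist S x y - ε ≤ wordDist T (f x) (f y) ∧
      wordDist T (f x) (f y) ≤ K * wordDist S x y + ε

/-- The inclusion of a subgroup as a homomorphism of Cayley graphs, when the generating set of the
group contains that of the subgroup. -/
def cayleyHom {H : Subgroup G} {S : Set H} {T : Set G} (hST : ∀ s ∈ S, (s : G) ∈ T) :
    SimpleGraph.mulCayley S →g SimpleGraph.mulCayley T where
  toFun h := h
  map_rel' {a b} hab := by
    rw [SimpleGraph.mulCayley_adj] at hab ⊢
    exact ⟨fun h => hab.1 (Subtype.ext h), hab.2.imp (hST _) (hST _)⟩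

/-- The natural map `Γ_H → Γ_G`. -/
noncomputable def cayleyInclusion {H : Subgroup G} {S : Set H} {T : Set G} (hS : Subgroup.closure S = ⊤)
    (hT : Subgroup.closure T = ⊤) (hST : ∀ s ∈ S, (s : G) ∈ T) :
    CayleySpace S hS → CayleySpace T hT :=
  GeometricRealization.map (mulCayley_connected hS) (mulCayley_connected hT) (cayleyHom hST)

/-- A Cannon–Thurston map exists for `(H, G)`: for every finite generating set `S` of `H` and every
finite generating set `T ⊇ S` of `G`, the natural map `Γ_H → Γ_G` of Cayley graphs extends to a
continuous map of the Gromov compactifications. -/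
def HasCannonThurstonMap (H : Subgroup G) : Prop :=
  ∀ (S : Set H) (T : Set G) (hS : Subgroup.closure S = ⊤) (hT : Subgroup.closure T = ⊤)
    (hST : ∀ s ∈ S, (s : G) ∈ T), S.Finite → T.Finite →
    ∃ F : GromovCompactification (CayleySpace S hS) (CayleySpace.base S hS) →
        GromovCompactification (CayleySpace T hT) (CayleySpace.base T hT),
      Continuous F ∧ ∀ x : CayleySpace S hS, F (.point x) = .point (cayleyInclusion hS hT hST x)

/-- The (pointwise) stabilizer of the edge joining `v` and `w`. For an action without inversions it
is also the setwise stabilizer of the edge. -/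
def edgeStabilizer (G : Type*) [Group G] {V : Type*} [MulAction G V] (v w : V) : Subgroup G :=
  MulAction.stabilizer G v ⊓ MulAction.stabilizer G w

/-- The action on the graph `T` is cocompact: the translates of some finite subgraph, spanned by the
finite vertex set `F`, cover all vertices and edges of `T`. -/
def IsCocompactAction (G : Type*) [Group G] {V : Type*} [MulAction G V] (T : SimpleGraph V) :
    Prop :=
  ∃ F : Set V, F.Finite ∧ (∀ v, ∃ g : G, g • v ∈ F) ∧
    ∀ v w, T.Adj v w → ∃ g : G, g • v ∈ F ∧ g • w ∈ F

end Groups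

/-! The extension exists once points of `H` with large Gromov product at `1` in `H` also have large
Gromov product in `G`: rays of `Γ_H` then map to paths converging to boundary points of `Γ_G`, and
the limits vary continuously (`PreservesLargeProducts.exists_continuous_extension`).

This estimate comes from Mitra's ladder. For a finite connected set `F` of vertices of `T`, the sets
`X_v = {g | g⁻¹ • v ∈ F}` (`vertexSpace`) cover `G`. If nonempty, `X_v` is a finite union of cosets
of `G_v`, and for an edge `X_u ∩ X_w` is one of cosets of `G_e`. Rips graphs at one large scale give
these sets path metrics, and cocompactness makes all constants uniform (`exists_treeOfSpaces`).

A geodesic `λ` of the root space `X_o` is continued outwards over the edges of `T`. If the edge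
space has small projection to the current rung, the ladder stops there; otherwise the two extreme
projections lie near the edge space, and points of it near them span the next rung
(`FourPoint.ladder_step`). Projections to consecutive rungs agree on edge spaces up to a bounded
error, because a projection is a center of a triangle and centers survive quasi-isometric
embeddings. They glue to a coarsely Lipschitz retraction of `G` onto the ladder, so `G`-geodesics
between points of the ladder stay near it (`IsLadder.near_ladder`, by the Morse-type lemma
`FourPoint.near_of_efficient`).

If the `G`-geodesic between the ends of `λ` passed near `1`, some point of the ladder near `1` would
lie in a rung at bounded depth. Following rungs back to the root gives a point of `λ` near `1` in
`G`, hence near `1` in `X_o`, since balls of `G` are finite (`gromov_product_large`). Vertex and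
edge groups embed quasi-isometrically in a vertex space, and such embeddings preserve large products
(`IsCoarseEmbedding.large_products`). -/

/-! ### Hyperbolicity of discrete geodesic spaces: four points and slim triangles. -/

/-- An integer-valued pseudometric in which any two points are joined by a discrete geodesic, such
as the path metric of a connected graph. -/
structure IsGeodesicDist {X : Type*} (d : X → X → ℕ) : Prop where
  self : ∀ x, d x x = 0
  comm : ∀ x y, d x y = d y x
  triangle : ∀ x y z, d x z ≤ d x y + d y z
  exists_geodesic : ∀ x y, ∃ γ : ℕ → X, γ 0 = x ∧ γ (d x y) = y ∧
    ∀ i j, i ≤ j → j ≤ d x y → d (γ i) (γ j) = j - i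

/-- The four point condition. -/
def FourPoint {X : Type*} (d : X → X → ℕ) (δ : ℕ) : Prop :=
  ∀ x y z w, d x z + d y w ≤ max (d x y + d z w) (d x w + d y z) + δ

/-- `p` lies on a geodesic from `a` to `b`. -/
def Between {X : Type*} (d : X → X → ℕ) (a b p : X) : Prop := d a p + d p b = d a b

/-- `f` is a quasi-isometric embedding with constant `K`. -/
structure IsCoarseEmbedding {X Y : Type*} (dX : X → X → ℕ) (dY : Y → Y → ℕ) (f : X → Y) (K : ℕ) :
    Prop where
  upper : ∀ x y, dY (f x) (f y) ≤ K * dX x y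
  lower : ∀ x y, dX x y ≤ K * dY (f x) (f y) + K

lemma IsCoarseEmbedding.mono {X Y : Type*} {dX : X → X → ℕ} {dY : Y → Y → ℕ} {f : X → Y} {K L : ℕ}
    (h : IsCoarseEmbedding dX dY f K) (hKL : K ≤ L) : IsCoarseEmbedding dX dY f L where
  upper x y := (h.upper x y).trans (Nat.mul_le_mul_right _ hKL)
  lower x y := (h.lower x y).trans (Nat.add_le_add (Nat.mul_le_mul_right _ hKL) hKL)

lemma IsCoarseEmbedding.comp {X Y Z : Type*} {dX : X → X → ℕ} {dY : Y → Y → ℕ} {dZ : Z → Z → ℕ}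
    {f : X → Y} {g : Y → Z} {K L : ℕ} (hg : IsCoarseEmbedding dY dZ g L)
    (hf : IsCoarseEmbedding dX dY f K) :
    IsCoarseEmbedding dX dZ (g ∘ f) (K * L + K) where
  upper x y := by
    have h1 := hg.upper (f x) (f y)
    have h2 := Nat.mul_le_mul_left L (hf.upper x y)
    have h3 : (K * L + K) * dX x y = L * (K * dX x y) + K * dX x y := by ring
    simp only [Function.comp]
    omega
  lower x y := by
    have h1 := hf.lower x y
    have h2 := Nat.mul_le_mul_left K (hg.lower (f x) (f y))
    have h3 : (K * L + K) * dZ (g (f x)) (g (f y)) + (K * L + K)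
      = K * (L * dZ (g (f x)) (g (f y)) + L) + K * dZ (g (f x)) (g (f y)) + K := by ring
    simp only [Function.comp]
    omega

section

variable {X : Type*} {d : X → X → ℕ} {δ : ℕ}

lemma FourPoint.mono {δ' : ℕ} (h : FourPoint d δ) (hδ : δ ≤ δ') : FourPoint d δ' :=
  fun x y z w => (h x y z w).trans (Nat.add_le_add_left hδ _)

namespace IsGeodesicDist

lemma exists_between (hd : IsGeodesicDist d) {a b : X} {n : ℕ} (hn : n ≤ d a b) :
    ∃ p, Between d a b p ∧ d a p = n := by
  obtain ⟨γ, h0, h1, h⟩ := hd.exists_geodesic a b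
  have h2 := h 0 n (Nat.zero_le _) hn
  have h3 := h n (d a b) hn le_rfl
  rw [h0] at h2
  rw [h1] at h3
  exact ⟨γ n, by unfold Between; omega, by omega⟩

lemma between_left (hd : IsGeodesicDist d) (a b : X) : Between d a b a := by
  have := hd.self a
  unfold Between; omega

lemma between_right (hd : IsGeodesicDist d) (a b : X) : Between d a b b := by
  have := hd.self b
  unfold Between; omega

lemma between_symm (hd : IsGeodesicDist d) {a b p : X} (h : Between d a b p) :
    Between d b a p := by
  unfold Between at *
  have h1 := hd.comm a p
  have h2 := hd.comm p b
  have h3 := hd.comm a b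
  omega

lemma between_trans (hd : IsGeodesicDist d) {a b p q : X} (hp : Between d a b p)
    (hq : Between d a p q) : Between d a b q := by
  unfold Between at *
  have h1 := hd.triangle a q b
  have h2 := hd.triangle q p b
  omega

lemma exists_geodesic_through (hd : IsGeodesicDist d) {a b p : X} (hp : Between d a b p) :
    ∃ γ : ℕ → X, γ 0 = a ∧ γ (d a b) = b ∧ γ (d a p) = p ∧
      ∀ i j, i ≤ j → j ≤ d a b → d (γ i) (γ j) = j - i := by
  obtain ⟨α, a0, a1, ha⟩ := hd.exists_geodesic a p
  obtain ⟨β, b0, b1, hb⟩ := hd.exists_geodesic p b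
  unfold Between at hp
  refine ⟨fun i => if i ≤ d a p then α i else β (i - d a p), by simp [a0], ?_, by simp [a1], ?_⟩
  · dsimp only
    split_ifs with h
    · have h0 : d p b = 0 := by omega
      rw [h0, b0] at b1
      rw [← b1, ← a1]
      congr 1
      rw [a1, b1]
    · rw [← b1]; congr 1; rw [b1]; omega
  · intro i j hij hj
    dsimp only
    split_ifs with h1 h2 h2
    · exact ha i j hij h2
    · have e1 := ha i (d a p) h1 le_rfl
      have e2 := hb 0 (j - d a p) (Nat.zero_le _) (by omega)
      have e3 := ha 0 i (Nat.zero_le _) h1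
      have e4 := hb (j - d a p) (d p b) (by omega) le_rfl
      rw [a1] at e1
      rw [b0] at e2
      rw [a0] at e3
      rw [b1] at e4
      have t1 := hd.triangle (α i) p (β (j - d a p))
      have t2 := hd.triangle a (α i) b
      have t3 := hd.triangle (α i) (β (j - d a p)) b
      omega
    · omega
    · rw [hb _ _ (by omega) (by omega)]; omega

end IsGeodesicDist

/-- Points that are almost between `a` and `b` are ordered by their distance from `a`. -/
lemma FourPoint.dist_le_of_almost_between (hd : IsGeodesicDist d) (h : FourPoint d δ) {a b p q : X}
    {e n : ℕ} (hp : d a p + d p b ≤ d a b + e) (hq : d a q + d q b ≤ d a b + e)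
    (h1 : d a p ≤ d a q + n) (h2 : d a q ≤ d a p + n) : d p q ≤ n + e + δ := by
  have h3 := h p a q b
  have h4 := hd.comm p a
  have h5 := hd.comm q a
  omega

lemma FourPoint.exists_between_of_almost (hd : IsGeodesicDist d) (h : FourPoint d δ) {a b p : X}
    {e : ℕ} (hp : d a p + d p b ≤ d a b + e) : ∃ q, Between d a b q ∧ d p q ≤ e + δ := by
  by_cases hle : d a p ≤ d a b
  · obtain ⟨q, hq, hq'⟩ := hd.exists_between hle
    refine ⟨q, hq, ?_⟩
    unfold Between at hq
    have := h.dist_le_of_almost_between hd (n := 0) hp (q := q) (by omega) (by omega) (by omega)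
    omega
  · exact ⟨b, hd.between_right a b, by omega⟩

/-- Geodesic triangles are slim. -/
lemma FourPoint.slim (hd : IsGeodesicDist d) (h : FourPoint d δ) {x z p : X} (y : X)
    (hp : Between d x z p) :
    ∃ q, d p q ≤ 2 * δ ∧ (Between d x y q ∨ Between d y z q) := by
  have h1 := h p x y z
  have h2 := h p z y x
  have c1 := hd.comm x p
  have c2 := hd.comm x z
  have c3 := hd.comm x y
  have c4 := hd.comm y z
  have c5 := hd.comm y p
  unfold Between at hp
  by_cases hc : d x p + d p y ≤ d x y + δ
  · obtain ⟨q, hq, hq'⟩ := h.exists_between_of_almost hd hc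
    exact ⟨q, by omega, Or.inl hq⟩
  · have hc' : d y p + d p z ≤ d y z + δ := by omega
    obtain ⟨q, hq, hq'⟩ := h.exists_between_of_almost hd hc'
    exact ⟨q, by omega, Or.inr hq⟩

/-- Slim triangles imply the four point condition. -/
lemma FourPoint.of_slim (hd : IsGeodesicDist d) (s : ℕ)
    (h : ∀ x y z p, Between d x z p → ∃ q, d p q ≤ s ∧ (Between d x y q ∨ Between d y z q)) :
    FourPoint d (4 * s + 2) := by
  intro x y z w
  -- Some point of the side from `x` to `z` is close to both other sides: take the last point of a
  -- geodesic that is `s`-close to the side from `x` to `w`; its successor is `s`-close to the third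
  -- side.
  obtain ⟨p, q₁, q₂, hp, hq₁, hq₂, h1, h2⟩ : ∃ p q₁ q₂, Between d x z p ∧ Between d x w q₁ ∧
      Between d w z q₂ ∧ d p q₁ ≤ s + 1 ∧ d p q₂ ≤ s + 1 := by
    obtain ⟨γ, h0, h1, hγ⟩ := hd.exists_geodesic x z
    have hb : ∀ i ≤ d x z, Between d x z (γ i) := fun i hi => by
      have e1 := hγ 0 i (Nat.zero_le _) hi
      have e2 := hγ i (d x z) hi le_rfl
      rw [h0] at e1
      rw [h1] at e2
      unfold Between; omega
    classical
    let P : ℕ → Prop := fun i => ∃ q, Between d x w q ∧ d (γ i) q ≤ s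
    have hP0 : P 0 := ⟨x, hd.between_left _ _, by rw [h0, hd.self]; omega⟩
    set m := Nat.findGreatest P (d x z) with hm
    have hPm : P m := Nat.findGreatest_spec (Nat.zero_le _) hP0
    have hmle : m ≤ d x z := Nat.findGreatest_le _
    obtain ⟨q₁, hq₁, hq₁'⟩ := hPm
    rcases hmle.lt_or_eq with hlt | heq
    · have hn : ¬ P (m + 1) := Nat.findGreatest_is_greatest (Nat.lt_succ_self _) hlt
      obtain ⟨q, hq, hq' | hq'⟩ := h x w z (γ (m + 1)) (hb _ hlt)
      · exact absurd ⟨q, hq', hq⟩ hn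
      · have e := hγ m (m + 1) (Nat.le_succ _) hlt
        have t := hd.triangle (γ m) (γ (m + 1)) q
        exact ⟨γ m, q₁, q, hb m hmle, hq₁, hq', by omega, by omega⟩
    · refine ⟨z, q₁, z, hd.between_right _ _, hq₁, hd.between_right _ _, ?_, ?_⟩
      · rw [heq, h1] at hq₁'; omega
      · rw [hd.self]; omega
  unfold Between at *
  have cz := hd.comm z q₂
  have cw := hd.comm w q₂
  have czw := hd.comm z w
  have cw' := hd.comm w q₁
  have cp1 := hd.comm p q₁
  have cp2 := hd.comm p q₂
  -- Both `d x z` and `d y w` are estimated through `p`. Each estimate passes once from `q` to `p`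
  -- and once from `p` to `q₁` or `q₂`, which gives `2 * (s + (s + 1))`.
  obtain ⟨q, hq, hq' | hq'⟩ := h x y z p hp
  · have t1 := hd.triangle x q z
    have t2 := hd.triangle q p z
    have t3 := hd.triangle p q₂ z
    have t4 := hd.triangle y q w
    have t5 := hd.triangle q p w
    have t6 := hd.triangle p q₂ w
    have c1 := hd.comm y q
    have c2 := hd.comm q p
    omega
  · have t1 := hd.triangle x q₁ z
    have t2 := hd.triangle q₁ p z
    have t3 := hd.triangle p q z
    have t4 := hd.triangle y q w
    have t5 := hd.triangle q p w
    have t6 := hd.triangle p q₁ w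
    have c1 := hd.comm y q
    have c2 := hd.comm q p
    omega

/-! ### Exponential divergence and stability of quasi-geodesics. -/

/-- Along a chain of `2 ^ k` short steps that avoids a ball of radius `D` around `p`, the Gromov
product based at `p` drops at most to about `D - k * δ / 2`. -/
lemma FourPoint.chain_bound (hd : IsGeodesicDist d) (h : FourPoint d δ) {z : ℕ → X} {p : X}
    {c D N : ℕ} (hz : ∀ i ≤ N, D ≤ d p (z i)) (hc : ∀ i < N, d (z i) (z (i + 1)) ≤ c) (k : ℕ) :
    ∀ i j, i ≤ j → j ≤ i + 2 ^ k → j ≤ N →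
      2 * D + d (z i) (z j) ≤ d p (z i) + d p (z j) + c + k * δ := by
  induction k with
  | zero =>
    intro i j hij hj hN
    have h1 := hz i (hij.trans hN)
    have h2 := hz j hN
    rcases (show j = i ∨ j = i + 1 by simp at hj; omega) with rfl | rfl
    · rw [hd.self]; omega
    · have := hc i (by omega); omega
  | succ k ih =>
    intro i j hij hj hN
    rw [pow_succ] at hj
    -- Cutting the chain in two halves of at most `2 ^ k` steps costs one application of the four
    -- point condition, hence one `δ` per halving.
    obtain ⟨m, hm⟩ : ∃ m, m = min j (i + 2 ^ k) := ⟨_, rfl⟩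
    have h1 := ih i m (by omega) (by omega) (by omega)
    have h2 := ih m j (by omega) (by omega) (by omega)
    have h3 := h (z i) (z m) (z j) p
    have c1 := hd.comm (z i) p
    have c2 := hd.comm (z m) p
    have c3 := hd.comm (z j) p
    have e : (k + 1) * δ = k * δ + δ := by ring
    omega

end

/-- A chain of length linear in `D` needs only about `log D` halvings, so the loss `k * δ` in
`FourPoint.chain_bound` is eventually smaller than `2 * D`. -/
lemma exists_detour_threshold (δ c C : ℕ) :
    ∃ D₀ : ℕ, ∀ D, D₀ < D → ∃ k, C * (6 * D + 1) ≤ 2 ^ k ∧ c + k * δ + 2 * δ < 2 * D := by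
  obtain ⟨n, hn⟩ : ∃ n : ℕ, ∀ k ≥ n, C * (6 * (c + (k + 3) * δ + k) + 7) ≤ 2 ^ k := by
    have h1 : Tendsto (fun n : ℕ => ((n : ℝ) ^ 1 / 2 ^ n)) atTop (𝓝 0) :=
      tendsto_pow_const_div_const_pow_of_one_lt 1 one_lt_two
    have h2 : Tendsto (fun n : ℕ => ((n : ℝ) ^ 0 / 2 ^ n)) atTop (𝓝 0) :=
      tendsto_pow_const_div_const_pow_of_one_lt 0 one_lt_two
    have h3 := ((h1.const_mul (C * (6 * (δ + 1)) : ℝ)).add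
      (h2.const_mul (C * (6 * (c + 3 * δ) + 7) : ℝ)))
    simp only [mul_zero, add_zero] at h3
    obtain ⟨n, hn⟩ := eventually_atTop.1 (h3.eventually (gt_mem_nhds one_pos))
    refine ⟨n, fun k hk => ?_⟩
    have h4 := hn k hk
    have h5 : (0 : ℝ) < 2 ^ k := by positivity
    rw [← mul_div_assoc, ← mul_div_assoc, ← add_div, div_lt_one h5] at h4
    have h6 : ((C * (6 * (c + (k + 3) * δ + k) + 7) : ℕ) : ℝ) ≤ (2 ^ k : ℕ) := by
      push_cast
      nlinarith
    exact_mod_cast h6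
  refine ⟨c + (n + 3) * δ + n, fun D hD => ?_⟩
  -- The largest `k` allowed by the second inequality grows linearly with `D`. By maximality `D ≤ c
  -- + (k + 3) * δ + k + 1`, which turns the first inequality into a statement about `k` alone, true
  -- for `k ≥ n`.
  let k := Nat.findGreatest (fun k => c + (k + 2) * δ + k < D) D
  have hk0 : c + (n + 2) * δ + n < D := by nlinarith
  have hkn : n ≤ k := Nat.le_findGreatest (by omega) hk0
  have hk : c + (k + 2) * δ + k < D :=
    Nat.findGreatest_spec (P := fun k => c + (k + 2) * δ + k < D) (by omega) hk0
  have hk' : ¬ (c + (k + 1 + 2) * δ + (k + 1) < D) := by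
    intro hlt
    exact Nat.findGreatest_is_greatest (P := fun k => c + (k + 2) * δ + k < D)
      (Nat.lt_succ_self k) (by omega) hlt
  refine ⟨k, le_trans (Nat.mul_le_mul_left C ?_) (hn k hkn), ?_⟩
  · have e : (k + 1 + 2) * δ = (k + 3) * δ := by ring
    omega
  · nlinarith

/-- The constant of `FourPoint.near_of_efficient`. -/
noncomputable def detourConst (δ c C : ℕ) : ℕ := (exists_detour_threshold δ c C).choose

/-- If any two points of `B` are joined by a chain in `B` whose number of steps is controlled by
their distance, then geodesics between points of `B` stay close to `B`. -/
lemma FourPoint.near_of_efficient {X : Type*} {d : X → X → ℕ} {δ : ℕ} (hd : IsGeodesicDist d)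
    (h : FourPoint d δ) {B : Set X} {c C : ℕ}
    (hB : ∀ b₁ ∈ B, ∀ b₂ ∈ B, ∃ (z : ℕ → X) (N : ℕ), N ≤ C * (d b₁ b₂ + 1) ∧ z 0 = b₁ ∧ z N = b₂ ∧
      (∀ i ≤ N, z i ∈ B) ∧ ∀ i < N, d (z i) (z (i + 1)) ≤ c)
    {x y p : X} (hx : x ∈ B) (hy : y ∈ B) (hp : Between d x y p) :
    ∃ b ∈ B, d p b ≤ detourConst δ c C := by
  by_contra! hcon
  classical
  -- The point farthest from `B` on geodesics from `x` to `y` is considered; its distance `D` then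
  -- bounds the distance to `B` of all the others.
  let P : ℕ → Prop := fun D => ∃ p, Between d x y p ∧ ∀ b ∈ B, D ≤ d p b
  have hP0 : P (detourConst δ c C + 1) := ⟨p, hp, hcon⟩
  have hPle : ∀ D, P D → D ≤ d x y := by
    rintro D ⟨q, hq, hq'⟩
    have h1 := hq' x hx
    have h2 := hd.comm x q
    unfold Between at hq
    omega
  obtain ⟨D, hD⟩ : ∃ D, D = Nat.findGreatest P (d x y) := ⟨_, rfl⟩
  have hPD : P D := hD ▸ Nat.findGreatest_spec (hPle _ hP0) hP0
  have hlt : detourConst δ c C < D := hD ▸ Nat.le_findGreatest (hPle _ hP0) hP0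
  have hnP : ¬ P (D + 1) := fun hc => by
    have := Nat.le_findGreatest (hPle _ hc) hc
    omega
  have near : ∀ q, Between d x y q → ∃ b ∈ B, d q b ≤ D := by
    intro q hq
    by_contra! hc
    exact hnP ⟨q, hq, fun b hb => hc b hb⟩
  clear hcon hP0 hnP hD p hp
  obtain ⟨p, hp, hpB⟩ := hPD
  -- From `p`, walk a distance `2 * D` towards an end, or to the end itself if it is nearer, and
  -- then to a point `b` of `B`. The third condition says that the Gromov product of `q` and `b` at
  -- `p` is at least `D`.
  have side : ∀ x y, x ∈ B → Between d x y p → (∀ q, Between d x y q → ∃ b ∈ B, d q b ≤ D) →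
      ∃ q b, Between d x p q ∧ b ∈ B ∧ 2 * D + d q b ≤ d p q + d p b ∧ d p q ≤ 2 * D ∧
        d q b ≤ D := by
    intro x y hx hp near
    have c1 := hd.comm x p
    by_cases h2 : 2 * D ≤ d x p
    · obtain ⟨q, hq, hq'⟩ := hd.exists_between (a := x) (b := p) (n := d x p - 2 * D) (by omega)
      obtain ⟨b, hb, hb'⟩ := near q (hd.between_trans hp hq)
      have h3 := hpB b hb
      have h4 := hd.comm p q
      have hq1 := hq
      unfold Between at hq
      exact ⟨q, b, hq1, hb, by omega, by omega, hb'⟩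
    · have h3 := hpB x hx
      exact ⟨x, x, hd.between_left _ _, hx, by rw [hd.self]; omega, by omega, by rw [hd.self]; omega⟩
  obtain ⟨p₁, b₁, hp₁, hb₁, e₁, f₁, g₁⟩ := side x y hx hp near
  obtain ⟨p₂, b₂, hp₂, hb₂, e₂, f₂, g₂⟩ := side y x hy (hd.between_symm hp)
    fun q hq => near q (hd.between_symm hq)
  obtain ⟨z, N, hN, z0, zN, hz, hzc⟩ := hB b₁ hb₁ b₂ hb₂
  obtain ⟨k, hk, hk'⟩ := (exists_detour_threshold δ c C).choose_spec D hlt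
  have hbb : d b₁ b₂ ≤ 6 * D := by
    have t1 := hd.triangle b₁ p₁ b₂
    have t2 := hd.triangle p₁ p₂ b₂
    have t3 := hd.triangle p₁ p p₂
    have c1 := hd.comm b₁ p₁
    have c2 := hd.comm p₁ p
    omega
  have hN' : N ≤ 2 ^ k := hN.trans ((Nat.mul_le_mul_left C (by omega)).trans hk)
  have key := h.chain_bound hd (z := z) (p := p) (D := D) (fun i hi => hpB _ (hz i hi)) hzc k 0 N
    (Nat.zero_le _) (by omega) le_rfl
  rw [z0, zN] at key
  -- Consecutive terms of `p₁`, `b₁`, `b₂`, `p₂` have large Gromov product at `p`. Two applications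
  -- of the four point condition make the product of `p₁` and `p₂` positive, but it is zero because
  -- `p` lies between them.
  have q1 := h p₁ b₁ p₂ p
  have q2 := h b₁ b₂ p₂ p
  have hpp : d p₁ p₂ = d p p₁ + d p p₂ := by
    unfold Between at hp hp₁ hp₂
    have t1 := hd.triangle x p₁ y
    have t2 := hd.triangle p₁ p₂ y
    have t3 := hd.triangle p₁ p p₂
    have c1 := hd.comm p₁ p
    have c2 := hd.comm p₂ p
    have c3 := hd.comm y p₂
    have c4 := hd.comm y p
    omega
  have c1 := hd.comm p₁ p
  have c2 := hd.comm p₂ p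
  have c3 := hd.comm b₁ p
  have c4 := hd.comm b₂ p
  have c5 := hd.comm b₂ p₂
  omega

/-- Stability constants for quasi-geodesics. -/
noncomputable def morseConst (δ K : ℕ) : ℕ :=
  detourConst δ K K + K * (K * (2 * detourConst δ K K + 1) + K)

section

variable {X Y : Type*} {dX : X → X → ℕ} {dY : Y → Y → ℕ} {f : X → Y} {δ K : ℕ}

lemma IsGeodesicDist.between_of_geodesic {X : Type*} {d : X → X → ℕ} {x y : X} {γ : ℕ → X}
    (h0 : γ 0 = x) (h1 : γ (d x y) = y)
    (hγ : ∀ i j, i ≤ j → j ≤ d x y → d (γ i) (γ j) = j - i) {i : ℕ} (hi : i ≤ d x y) :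
    Between d x y (γ i) := by
  have e1 := hγ 0 i (Nat.zero_le _) hi
  have e2 := hγ i (d x y) hi le_rfl
  rw [h0] at e1
  rw [h1] at e2
  unfold Between; omega

/-- The images of the points of `γ` are an efficient chain in the sense of
`FourPoint.near_of_efficient`: steps have length at most `K`, and `lower` bounds their number by `K
* (dY _ _ + 1)`. -/
lemma IsCoarseEmbedding.near_geodesic_image (hY : IsGeodesicDist dY)
    (h : FourPoint dY δ) (hf : IsCoarseEmbedding dX dY f K) {x y : X} {γ : ℕ → X}
    (h0 : γ 0 = x) (h1 : γ (dX x y) = y)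
    (hγ : ∀ i j, i ≤ j → j ≤ dX x y → dX (γ i) (γ j) = j - i) {p : Y}
    (hp : Between dY (f x) (f y) p) :
    ∃ i ≤ dX x y, dY p (f (γ i)) ≤ detourConst δ K K := by
  let B : Set Y := {q | ∃ i ≤ dX x y, f (γ i) = q}
  have up : ∀ i j, i ≤ j → j ≤ dX x y → ∃ (z : ℕ → Y) (N : ℕ),
      N ≤ K * (dY (f (γ i)) (f (γ j)) + 1) ∧ z 0 = f (γ i) ∧ z N = f (γ j) ∧
      (∀ i ≤ N, z i ∈ B) ∧ ∀ i < N, dY (z i) (z (i + 1)) ≤ K := by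
    intro i j hij hj
    refine ⟨fun t => f (γ (i + t)), j - i, ?_, rfl, ?_, ?_, ?_⟩
    · have := hf.lower (γ i) (γ j)
      rw [hγ i j hij hj] at this
      rw [mul_add, mul_one]; exact this
    · simp only []; congr 2; omega
    · exact fun t ht => ⟨i + t, by omega, rfl⟩
    · intro t ht
      have := hf.upper (γ (i + t)) (γ (i + (t + 1)))
      rw [hγ _ _ (by omega) (by omega)] at this
      have e : i + (t + 1) - (i + t) = 1 := by omega
      rw [e, mul_one] at this
      exact this
  have hB : ∀ b₁ ∈ B, ∀ b₂ ∈ B, ∃ (z : ℕ → Y) (N : ℕ), N ≤ K * (dY b₁ b₂ + 1) ∧ z 0 = b₁ ∧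
      z N = b₂ ∧ (∀ i ≤ N, z i ∈ B) ∧ ∀ i < N, dY (z i) (z (i + 1)) ≤ K := by
    rintro _ ⟨i, hi, rfl⟩ _ ⟨j, hj, rfl⟩
    rcases le_total i j with hij | hij
    · exact up i j hij hj
    · obtain ⟨z, N, hN, z0, zN, hz, hzc⟩ := up j i hij hi
      refine ⟨fun t => z (N - t), N, by rw [hY.comm]; exact hN, by simpa using zN, by simpa using z0,
        fun t ht => hz _ (by omega), fun t ht => ?_⟩
      have := hzc (N - (t + 1)) (by omega)
      rw [hY.comm]
      rwa [show N - (t + 1) + 1 = N - t by omega] at this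
  obtain ⟨b, ⟨i, hi, rfl⟩, hb⟩ := h.near_of_efficient hY hB
    (x := f x) (y := f y) ⟨0, Nat.zero_le _, by rw [h0]⟩ ⟨_, le_rfl, by rw [h1]⟩ hp
  exact ⟨i, hi, hb⟩

/-- Geodesics between points of the image of a quasi-isometric embedding into a hyperbolic space
stay close to the images of geodesics. -/
lemma IsCoarseEmbedding.exists_between_near (hX : IsGeodesicDist dX) (hY : IsGeodesicDist dY)
    (h : FourPoint dY δ) (hf : IsCoarseEmbedding dX dY f K) {x y : X} {p : Y}
    (hp : Between dY (f x) (f y) p) : ∃ z, Between dX x y z ∧ dY p (f z) ≤ morseConst δ K := by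
  obtain ⟨γ, h0, h1, hγ⟩ := hX.exists_geodesic x y
  obtain ⟨i, hi, hi'⟩ := hf.near_geodesic_image hY h h0 h1 hγ hp
  exact ⟨γ i, IsGeodesicDist.between_of_geodesic h0 h1 hγ hi, by unfold morseConst; omega⟩

/-- Quasi-isometric embeddings into hyperbolic spaces map geodesics close to geodesics. -/
lemma IsCoarseEmbedding.image_near_between (hX : IsGeodesicDist dX) (hY : IsGeodesicDist dY)
    (h : FourPoint dY δ) (hf : IsCoarseEmbedding dX dY f K) {x y z : X}
    (hz : Between dX x y z) : ∃ p, Between dY (f x) (f y) p ∧ dY (f z) p ≤ morseConst δ K := by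
  obtain ⟨γ, h0, h1, h2, hγ⟩ := hX.exists_geodesic_through hz
  obtain ⟨α, a0, a1, hα⟩ := hY.exists_geodesic (f x) (f y)
  have hzle : dX x z ≤ dX x y := by unfold Between at hz; omega
  obtain ⟨D, hD⟩ : ∃ D, D = detourConst δ K K := ⟨_, rfl⟩
  have near : ∀ t ≤ dY (f x) (f y), ∃ i ≤ dX x y, dY (α t) (f (γ i)) ≤ D := fun t ht => by
    rw [hD]
    exact hf.near_geodesic_image hY h h0 h1 hγ (IsGeodesicDist.between_of_geodesic a0 a1 hα ht)
  -- Connectedness argument: `α t` is the last point near the image of the part of `γ` before `z`,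
  -- so its successor is near the image of the part after `z`. The two image points are `2 * D + 1`
  -- apart, so `j - i` is bounded, and `z` sits between `γ i` and `γ j`.
  obtain ⟨t, i, j, ht, hi, hj, e1, e2⟩ : ∃ t i j, t ≤ dY (f x) (f y) ∧ i ≤ dX x z ∧
      (dX x z ≤ j ∧ j ≤ dX x y) ∧ dY (α t) (f (γ i)) ≤ D ∧ dY (α t) (f (γ j)) ≤ D + 1 := by
    classical
    let P : ℕ → Prop := fun t => ∃ i ≤ dX x z, dY (α t) (f (γ i)) ≤ D
    have hP0 : P 0 := ⟨0, Nat.zero_le _, by rw [a0, h0, hY.self]; omega⟩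
    obtain ⟨m, hm⟩ : ∃ m, m = Nat.findGreatest P (dY (f x) (f y)) := ⟨_, rfl⟩
    have hPm : P m := hm ▸ Nat.findGreatest_spec (Nat.zero_le _) hP0
    have hmle : m ≤ dY (f x) (f y) := hm ▸ Nat.findGreatest_le _
    obtain ⟨i, hi, hi'⟩ := hPm
    rcases hmle.lt_or_eq with hlt | heq
    · have hn : ¬ P (m + 1) :=
        Nat.findGreatest_is_greatest (hm ▸ Nat.lt_succ_self _) hlt
      obtain ⟨j, hj, hj'⟩ := near (m + 1) hlt
      have hj2 : dX x z ≤ j := by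
        by_contra hc
        exact hn ⟨j, by omega, hj'⟩
      have e := hα m (m + 1) (Nat.le_succ _) hlt
      have t := hY.triangle (α m) (α (m + 1)) (f (γ j))
      exact ⟨m, i, j, hmle, hi, ⟨hj2, hj⟩, hi', by omega⟩
    · exact ⟨m, i, dX x y, hmle, hi, ⟨hzle, le_rfl⟩, hi', by rw [heq, a1, h1, hY.self]; omega⟩
  refine ⟨α t, IsGeodesicDist.between_of_geodesic a0 a1 hα ht, ?_⟩
  have hij := hf.lower (γ i) (γ j)
  rw [hγ i j (by omega) hj.2] at hij
  have hd : dY (f (γ i)) (f (γ j)) ≤ 2 * D + 1 := by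
    have t1 := hY.triangle (f (γ i)) (α t) (f (γ j))
    have c1 := hY.comm (f (γ i)) (α t)
    omega
  have hu := hf.upper (γ i) (γ (dX x z))
  rw [hγ i _ hi hzle, h2] at hu
  have m1 := Nat.mul_le_mul_left K hd
  have m2 : K * (dX x z - i) ≤ K * (K * (2 * D + 1) + K) := Nat.mul_le_mul_left K (by omega)
  have t1 := hY.triangle (f z) (f (γ i)) (α t)
  have c1 := hY.comm (f z) (f (γ i))
  have c2 := hY.comm (f (γ i)) (α t)
  unfold morseConst
  rw [← hD]
  omega

/-- Hyperbolicity passes to quasi-isometrically embedded spaces. -/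
lemma IsCoarseEmbedding.fourPoint (hX : IsGeodesicDist dX) (hY : IsGeodesicDist dY)
    (h : FourPoint dY δ) (hf : IsCoarseEmbedding dX dY f K) :
    FourPoint dX (4 * (K * (2 * morseConst δ K + 2 * δ) + K) + 2) := by
  refine FourPoint.of_slim hX _ fun x y z p hp => ?_
  obtain ⟨q, hq, hq'⟩ := hf.image_near_between hX hY h hp
  obtain ⟨q₂, h2, h2'⟩ := h.slim hY (f y) hq
  have fin : ∀ r, dY q₂ (f r) ≤ morseConst δ K → dX p r ≤ K * (2 * morseConst δ K + 2 * δ) + K := by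
    intro r hr
    refine (hf.lower p r).trans (Nat.add_le_add_right (Nat.mul_le_mul_left K ?_) K)
    have t1 := hY.triangle (f p) q (f r)
    have t2 := hY.triangle q q₂ (f r)
    omega
  rcases h2' with h3 | h3
  · obtain ⟨r, hr, hr'⟩ := hf.exists_between_near hX hY h h3
    exact ⟨r, fin r hr', Or.inl hr⟩
  · obtain ⟨r, hr, hr'⟩ := hf.exists_between_near hX hY h h3
    exact ⟨r, fin r hr', Or.inr hr⟩

end

/-! ### Centers of triangles and projections to geodesics. -/

/-- `c` is an `e`-center of the triple `a`, `b`, `p`: it is almost between any two of them. -/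
structure IsCenter {X : Type*} (d : X → X → ℕ) (e : ℕ) (a b p c : X) : Prop where
  ab : d a c + d c b ≤ d a b + e
  ap : d a c + d c p ≤ d a p + e
  bp : d b c + d c p ≤ d b p + e

section

variable {X : Type*} {d : X → X → ℕ} {δ : ℕ}

lemma IsCenter.mono {e e' : ℕ} {a b p c : X} (h : IsCenter d e a b p c) (he : e ≤ e') :
    IsCenter d e' a b p c where
  ab := h.ab.trans (by omega)
  ap := h.ap.trans (by omega)
  bp := h.bp.trans (by omega)

/-- The three inequalities force `d a c` to be nearly the Gromov product `(b, p)_a`. Hence `d a c`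
and `d a c'` differ by at most `2 * e`, and points almost between `a` and `b` are ordered by their
distance from `a`. -/
lemma IsCenter.dist_le (hd : IsGeodesicDist d) (h : FourPoint d δ) {e : ℕ} {a b p c c' : X}
    (hc : IsCenter d e a b p c) (hc' : IsCenter d e a b p c') : d c c' ≤ 3 * e + δ := by
  obtain ⟨h1, h2, h3⟩ := hc
  obtain ⟨k1, k2, k3⟩ := hc'
  have c1 := hd.comm b c
  have c2 := hd.comm b c'
  have c3 := hd.comm b p
  have t1 := hd.triangle a c b
  have t2 := hd.triangle a c p
  have t3 := hd.triangle b c p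
  have s1 := hd.triangle a c' b
  have s2 := hd.triangle a c' p
  have s3 := hd.triangle b c' p
  have := h.dist_le_of_almost_between hd (n := 2 * e) h1 k1 (by omega) (by omega)
  omega

namespace IsGeodesicDist

lemma exists_proj (hd : IsGeodesicDist d) (a b p : X) :
    ∃ c, Between d a b c ∧ d a c = (d a b + d a p - d b p) / 2 := by
  refine hd.exists_between ?_
  have t := hd.triangle a b p
  have t2 := hd.triangle b a p
  have t3 := hd.comm a b
  have t4 := hd.triangle a p b
  have t5 := hd.comm p b
  omega

/-- The projection of `p` to a geodesic from `a` to `b`, at distance `(b, p)_a` from `a`. -/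
noncomputable def proj (hd : IsGeodesicDist d) (a b p : X) : X := (hd.exists_proj a b p).choose

lemma between_proj (hd : IsGeodesicDist d) (a b p : X) : Between d a b (hd.proj a b p) :=
  (hd.exists_proj a b p).choose_spec.1

lemma dist_proj (hd : IsGeodesicDist d) (a b p : X) :
    d a (hd.proj a b p) = (d a b + d a p - d b p) / 2 :=
  (hd.exists_proj a b p).choose_spec.2

/-- At distance `(b, p)_a` from `a`, the two terms of the maximum in the four point condition for
`p`, `a`, `c`, `b` balance, up to the rounding of a half-integer; this is the `+ 1`. -/
lemma isCenter_proj (hd : IsGeodesicDist d) (h : FourPoint d δ) (a b p : X) :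
    IsCenter d (δ + 1) a b p (hd.proj a b p) := by
  have h1 := hd.between_proj a b p
  have h2 := hd.dist_proj a b p
  set c := hd.proj a b p
  unfold Between at h1
  have h3 := h p a c b
  have c1 := hd.comm p a
  have c2 := hd.comm p b
  have c3 := hd.comm p c
  have c4 := hd.comm a c
  have c5 := hd.comm b c
  have t := hd.triangle a b p
  have t2 := hd.triangle b a p
  have t3 := hd.comm a b
  constructor <;> omega

lemma proj_dist_le (hd : IsGeodesicDist d) (h : FourPoint d δ) (a b p q : X) :
    d (hd.proj a b p) (hd.proj a b q) ≤ d p q + 1 + δ := by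
  have h1 := hd.between_proj a b p
  have h2 := hd.dist_proj a b p
  have h3 := hd.between_proj a b q
  have h4 := hd.dist_proj a b q
  unfold Between at h1 h3
  have t1 := hd.triangle a p q
  have t2 := hd.triangle a q p
  have t3 := hd.triangle b p q
  have t4 := hd.triangle b q p
  have t5 := hd.comm p q
  have := h.dist_le_of_almost_between hd (e := 0) (n := d p q + 1) h1.le h3.le (by omega) (by omega)
  omega

lemma proj_dist_self (hd : IsGeodesicDist d) (h : FourPoint d δ) {a b p : X}
    (hp : Between d a b p) : d (hd.proj a b p) p ≤ 1 + δ := by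
  have h1 := hd.between_proj a b p
  have h2 := hd.dist_proj a b p
  unfold Between at h1 hp
  have t3 := hd.comm p b
  have := h.dist_le_of_almost_between hd (e := 0) (n := 1) h1.le hp.le (by omega) (by omega)
  omega

end IsGeodesicDist

end

/-- How far quasi-isometric embeddings between hyperbolic spaces distort centers. -/
noncomputable def centerConst (δ K : ℕ) : ℕ :=
  2 * (K * (2 * (4 * (K * (2 * morseConst δ K + 2 * δ) + K) + 2) + 1) + morseConst δ K)

section

variable {E Y : Type*} {dE : E → E → ℕ} {dY : Y → Y → ℕ} {f : E → Y} {δ K : ℕ}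

lemma IsCoarseEmbedding.almost_between (hE : IsGeodesicDist dE) (hY : IsGeodesicDist dY)
    (h : FourPoint dY δ) (hf : IsCoarseEmbedding dE dY f K) {e δE : ℕ} (h' : FourPoint dE δE)
    {x y z : E} (hz : dE x z + dE z y ≤ dE x y + e) :
    dY (f x) (f z) + dY (f z) (f y) ≤
      dY (f x) (f y) + 2 * (K * (e + δE) + morseConst δ K) := by
  obtain ⟨q, hq, hq'⟩ := h'.exists_between_of_almost hE hz
  obtain ⟨p, hp, hp'⟩ := hf.image_near_between hE hY h hq
  have u := (hf.upper z q).trans (Nat.mul_le_mul_left K hq')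
  have t1 := hY.triangle (f z) (f q) p
  have t2 := hY.triangle (f x) p (f z)
  have t3 := hY.triangle (f z) p (f y)
  have c1 := hY.comm (f z) p
  unfold Between at hp
  omega

/-- Combined with the coarse uniqueness of centers, this says that projecting in `E` and then
applying `f` is coarsely the same as projecting in `Y`. The bound on `δE` is the constant of
`IsCoarseEmbedding.fourPoint`, so that the result depends on `δ` and `K` only. -/
lemma IsCoarseEmbedding.isCenter_proj (hE : IsGeodesicDist dE) (hY : IsGeodesicDist dY)
    (h : FourPoint dY δ) (hf : IsCoarseEmbedding dE dY f K) {δE : ℕ} (h' : FourPoint dE δE)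
    (hδE : δE ≤ 4 * (K * (2 * morseConst δ K + 2 * δ) + K) + 2) (a b p : E) :
    IsCenter dY (centerConst δ K) (f a) (f b) (f p) (f (hE.proj a b p)) := by
  have h1 := hE.isCenter_proj h' a b p
  have hle : 2 * (K * (δE + 1 + δE) + morseConst δ K) ≤ centerConst δ K := by
    exact Nat.mul_le_mul_left 2 (Nat.add_le_add_right (Nat.mul_le_mul_left K (by omega)) _)
  exact ⟨(hf.almost_between hE hY h h' h1.ab).trans (Nat.add_le_add_left hle _),
    (hf.almost_between hE hY h h' h1.ap).trans (Nat.add_le_add_left hle _),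
    (hf.almost_between hE hY h h' h1.bp).trans (Nat.add_le_add_left hle _)⟩

end

/-! ### Continuing a geodesic across an edge space. -/

/-- If the projections `c₁`, `c₂` of `p`, `q` to a geodesic are far apart, then `c₁` is almost
between `p` and `q`. -/
lemma FourPoint.proj_almost_between {X : Type*} {d : X → X → ℕ} {δ e : ℕ} (hd : IsGeodesicDist d)
    (h : FourPoint d δ) {a b p q c₁ c₂ : X} (h₁ : IsCenter d e a b p c₁)
    (h₂ : IsCenter d e a b q c₂) (hb₁ : Between d a b c₁) (hb₂ : Between d a b c₂)
    (hlt : d a c₁ + (3 * e + 2 * δ) < d a c₂) :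
    d p c₁ + d c₁ q ≤ d p q + (e + 2 * δ) ∧ d p c₂ + d c₂ q ≤ d p q + (e + 2 * δ) := by
  have h12 := h.dist_le_of_almost_between hd (e := 0) (n := d a c₂ - d a c₁)
    hb₁.le hb₂.le (by omega) (by omega)
  unfold Between at hb₁ hb₂
  have k1 := h₁.bp
  have k2 := h₂.ap
  have t1 := hd.triangle b c₂ p
  have t2 := hd.triangle a c₁ q
  have c1 := hd.comm b c₁
  have c2 := hd.comm b c₂
  have c3 := hd.comm p c₂
  have c4 := hd.comm p c₁
  have c5 := hd.comm q c₁
  have c6 := hd.comm q c₂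
  have c7 := hd.comm c₁ c₂
  have key := h p q c₂ c₁
  have key2 := h p c₁ c₂ q
  have c8 := hd.comm p q
  omega

/-- The constant of `FourPoint.ladder_step`. -/
noncomputable def stepConst (δ K : ℕ) : ℕ :=
  3 * (4 * (3 * (δ + 1) + 3 * δ + morseConst δ K) + 2 * δ + 3 * (δ + 1) + centerConst δ K) + 3 * δ
    + 4 * morseConst δ K + 10

/-- Let `f : E → U` and `g : E → W` be quasi-isometric embeddings into hyperbolic spaces. Either the
projection of `E` to a geodesic of `U` is small, or the geodesic can be continued into `W`. -/
lemma FourPoint.ladder_step {E U W : Type*} {dE : E → E → ℕ} {dU : U → U → ℕ} {dW : W → W → ℕ}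
    {δ K : ℕ} [Nonempty E] (hE : IsGeodesicDist dE) (hU : IsGeodesicDist dU)
    (hW : IsGeodesicDist dW) (h : FourPoint dU δ) (h' : FourPoint dW δ) {f : E → U} {g : E → W}
    (hf : IsCoarseEmbedding dE dU f K) (hg : IsCoarseEmbedding dE dW g K) (a b : U) :
    (∃ c, Between dU a b c ∧ ∀ r, dU (hU.proj a b (f r)) c ≤ stepConst δ K) ∨
    ∃ a' b' : E,
      (∀ r, ∃ s, dU (hU.proj a b (f r)) (f s) ≤ stepConst δ K ∧
        dW (g s) (hW.proj (g a') (g b') (g r)) ≤ stepConst δ K) ∧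
      ∀ q, Between dW (g a') (g b') q → ∃ s, dW q (g s) ≤ stepConst δ K ∧
        ∃ q', Between dU a b q' ∧ dU (f s) q' ≤ stepConst δ K := by
  have hFE := hf.fourPoint hE hU h
  obtain ⟨M, hM⟩ : ∃ M, M = morseConst δ K := ⟨_, rfl⟩
  obtain ⟨Z, hZ⟩ : ∃ Z, Z = centerConst δ K := ⟨_, rfl⟩
  obtain ⟨S, hS⟩ : ∃ S, S = stepConst δ K := ⟨_, rfl⟩
  have hS' := hS
  rw [stepConst, ← hM, ← hZ] at hS'
  rw [← hS]
  -- The position along `a b` of the projection of a point of `E`. Points `p` and `q` with extreme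
  -- positions decide between the two alternatives; the threshold `3 * (δ + 1) + 2 * δ` is that of
  -- `FourPoint.proj_almost_between` with `e = δ + 1`.
  let pos : E → ℕ := fun r => dU a (hU.proj a b (f r))
  obtain ⟨p, hp⟩ : ∃ p, ∀ r, pos p ≤ pos r :=
    ⟨Function.argmin pos, fun r => Function.argmin_le pos r⟩
  have hbt : ∀ r, Between dU a b (hU.proj a b (f r)) := fun r => hU.between_proj _ _ _
  obtain ⟨q, hq⟩ : ∃ q, ∀ r, pos r ≤ pos q := by
    let neg : E → ℕ := fun r => dU a b - pos r
    refine ⟨Function.argmin neg, fun r => ?_⟩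
    have h1 := Function.argmin_le neg r
    have h2 := hbt r
    simp only [neg, pos] at *
    unfold Between at h2
    omega
  by_cases hsmall : pos q ≤ pos p + (3 * (δ + 1) + 2 * δ)
  · left
    refine ⟨_, hbt p, fun r => ?_⟩
    have h1 := hp r
    have h2 := hq r
    have := h.dist_le_of_almost_between hU (e := 0) (n := 3 * (δ + 1) + 2 * δ)
      (hbt r).le (hbt p).le (by simp only [pos] at *; omega) (by simp only [pos] at *; omega)
    omega
  right
  -- Quasiconvexity of the image of `E`: the two extreme projections are almost between `f p` and `f
  -- q`, hence close to `f a'` and `f b'` for some `a'`, `b'` in `E`.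
  have near : ∀ c, dU (f p) c + dU c (f q) ≤ dU (f p) (f q) + (δ + 1 + 2 * δ) →
      ∃ z, dU c (f z) ≤ δ + 1 + 3 * δ + M := by
    intro c hc
    obtain ⟨s, hs, hs'⟩ := h.exists_between_of_almost hU hc
    obtain ⟨z, hz, hz'⟩ := hf.exists_between_near hE hU h hs
    have t := hU.triangle c s (f z)
    exact ⟨z, by omega⟩
  have hcp := hU.isCenter_proj h a b (f p)
  have hcq := hU.isCenter_proj h a b (f q)
  obtain ⟨k1, k2⟩ := h.proj_almost_between hU hcp hcq (hbt p) (hbt q)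
    (by simp only [pos] at hsmall; omega)
  obtain ⟨a', ha'⟩ := near _ k1
  obtain ⟨b', hb'⟩ := near _ k2
  have bp := hbt p
  have bq := hbt q
  have bp' := bp
  have bq' := bq
  simp only [pos] at hp hq hsmall
  obtain ⟨cp, ecp⟩ : ∃ c, c = hU.proj a b (f p) := ⟨_, rfl⟩
  obtain ⟨cq, ecq⟩ : ∃ c, c = hU.proj a b (f q) := ⟨_, rfl⟩
  rw [← ecp] at hp hsmall ha' bp bp'
  rw [← ecq] at hq hsmall hb' bq bq'
  clear k1 k2 near hcp hcq ecp ecq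
  unfold Between at bp bq
  have tpq := hU.triangle a cp cq
  have tpq1 := h.dist_le_of_almost_between hU (e := 0) (n := dU a cq - dU a cp)
    bp'.le bq'.le (by omega) (by omega)
  have ta1 := hU.triangle cp (f a') cq
  have ta2 := hU.triangle (f a') (f b') cq
  have tb1 := hU.triangle (f a') cp (f b')
  have tb2 := hU.triangle cp cq (f b')
  have ca := hU.comm cp (f a')
  have cb := hU.comm cq (f b')
  refine ⟨a', b', fun r => ?_, fun s hs => ?_⟩
  -- Projection inside `E` mediates between `U` and `W`. Its image under `f` and the projection of
  -- `f r` to `a b` are both centers of `f a'`, `f b'`, `f r`; for the latter, the extremality of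
  -- `p` and `q` is what places it between the extreme projections.
  · refine ⟨hE.proj a' b' r, ?_, ?_⟩
    · have e1 : IsCenter dU (4 * (3 * (δ + 1) + 3 * δ + M) + 2 * δ + 3 * (δ + 1) + Z)
          (f a') (f b') (f r) (f (hE.proj a' b' r)) :=
        (hf.isCenter_proj hE hU h hFE le_rfl a' b' r).mono (by omega)
      have e2 : IsCenter dU (4 * (3 * (δ + 1) + 3 * δ + M) + 2 * δ + 3 * (δ + 1) + Z)
          (f a') (f b') (f r) (hU.proj a b (f r)) := by
        have hcr := hU.isCenter_proj h a b (f r)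
        have b1 := hbt r
        have h1 := hp r
        have h2 := hq r
        obtain ⟨c, ec⟩ : ∃ c, c = hU.proj a b (f r) := ⟨_, rfl⟩
        rw [← ec] at hcr b1 h1 h2 ⊢
        have d1 := h.dist_le_of_almost_between hU (e := 0) (n := dU a c - dU a cp)
          bp'.le b1.le (by omega) (by omega)
        have d2 := h.dist_le_of_almost_between hU (e := 0) (n := dU a cq - dU a c)
          b1.le bq'.le (by omega) (by omega)
        unfold Between at b1
        have s1 := hU.triangle (f a') cp c
        have s2 := hU.triangle c cq (f b')
        have s3 := hU.triangle a cp (f r)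
        have s4 := hU.triangle cp (f a') (f r)
        have s5 := hU.triangle b cq (f r)
        have s6 := hU.triangle cq (f b') (f r)
        have m1 := hcr.ap
        have m2 := hcr.bp
        have g1 := hU.comm b cq
        have g2 := hU.comm b c
        have g3 := hU.comm (f b') c
        constructor <;> omega
      have := e2.dist_le hU h e1
      omega
    · have e1 := hg.isCenter_proj hE hW h' hFE le_rfl a' b' r
      have e2 := hW.isCenter_proj h' (g a') (g b') (g r)
      have := (e1.mono (e' := δ + 1 + Z) (by omega)).dist_le hW h' (e2.mono (by omega))
      omega
  -- A point of the new rung is followed back: it is near `g z` for some `z` on a geodesic of `E`,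
  -- and `f z` is near a geodesic from `f a'` to `f b'`, whose ends are near `a b`.
  · obtain ⟨z, hz, hz'⟩ := hg.exists_between_near hE hW h' hs
    obtain ⟨y, hy, hy'⟩ := hf.image_near_between hE hU h hz
    unfold Between at hy
    have t1 := hU.triangle a (f a') (f z)
    have t2 := hU.triangle a cp (f a')
    have t3 := hU.triangle (f a') y (f z)
    have t4 := hU.triangle (f z) y (f b')
    have t5 := hU.triangle (f z) (f b') b
    have t6 := hU.triangle (f b') cq b
    have c1 := hU.comm y (f z)
    obtain ⟨q', hq', hq''⟩ := h.exists_between_of_almost hU (a := a) (b := b) (p := f z)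
      (e := 4 * (δ + 1 + 3 * δ + M) + 2 * M + δ) (by omega)
    exact ⟨z, by omega, q', hq', by omega⟩

/-! ### Rooted trees and recursion along them. -/

section Tree

variable {V : Type*} {T : SimpleGraph V}

lemma SimpleGraph.IsTree.parent_unique (hT : T.IsTree) {o u u' w : V} (h : T.Adj u w)
    (h' : T.Adj u' w) (hu : T.dist o w = T.dist o u + 1) (hu' : T.dist o w = T.dist o u' + 1) :
    u = u' := by
  have path : ∀ v, T.Adj v w → T.dist o w = T.dist o v + 1 →
      ∃ p : T.Walk o w, p.IsPath ∧ p.penultimate = v := by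
    intro v hv hd
    obtain ⟨p, hp⟩ := hT.connected.exists_walk_length_eq_dist o v
    refine ⟨p.concat hv, SimpleGraph.Walk.isPath_of_length_eq_dist _ ?_, by simp⟩
    rw [SimpleGraph.Walk.length_concat, hp, hd]
  obtain ⟨p, hp, rfl⟩ := path u h hu
  obtain ⟨q, hq, rfl⟩ := path u' h' hu'
  rw [(hT.existsUnique_path o w).unique hp hq]

lemma SimpleGraph.IsTree.exists_parent (hT : T.IsTree) (o : V) {n : ℕ} {w : V} (hw : T.dist o w = n + 1) :
    ∃ u, T.Adj u w ∧ T.dist o u = n := by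
  obtain ⟨p, hp⟩ := hT.connected.exists_walk_length_eq_dist o w
  have hnn : ¬ p.Nil := by
    rw [SimpleGraph.Walk.not_nil_iff_lt_length]; omega
  have ha := p.adj_penultimate hnn
  refine ⟨_, ha, ?_⟩
  have h1 := SimpleGraph.dist_le p.dropLast
  have h2 : p.dropLast.length + 1 = p.length := by
    have := congrArg SimpleGraph.Walk.length (p.concat_dropLast ha)
    rwa [SimpleGraph.Walk.length_concat] at this
  have h3 := hT.connected.dist_triangle (u := o) (v := p.penultimate) (w := w)
  rw [SimpleGraph.dist_eq_one_iff_adj.2 ha] at h3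
  omega

/-- Recursion along a rooted tree: a family of choices that is related along every edge. -/
lemma SimpleGraph.IsTree.exists_family (hT : T.IsTree) (o : V) {S : V → Type*}
    (r : ∀ u w, S u → S w → Prop) (hr : ∀ u w, T.Adj u w → ∀ s, ∃ s', r u w s s') (s₀ : S o) :
    ∃ st : ∀ w, S w, st o = s₀ ∧
      ∀ u w, T.Adj u w → T.dist o w = T.dist o u + 1 → r u w (st u) (st w) := by
  classical
  have main : ∀ n : ℕ, ∀ w, T.dist o w = n → Nonempty (S w) := by
    intro n
    induction n with
    | zero =>
      intro w hw
      obtain rfl := hT.connected.dist_eq_zero_iff.1 hw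
      exact ⟨s₀⟩
    | succ n ih =>
      intro w hw
      obtain ⟨u, ha, hd⟩ := hT.exists_parent o hw
      obtain ⟨s⟩ := ih _ hd
      obtain ⟨s', -⟩ := hr _ _ ha s
      exact ⟨s'⟩
  let dflt : ∀ w, S w := fun w => (main _ w rfl).some
  let next : (∀ w, S w) → ∀ w, S w := fun st w =>
    if h : ∃ u, T.Adj u w ∧ T.dist o w = T.dist o u + 1 then
      (hr h.choose w h.choose_spec.1 (st h.choose)).choose
    else if h : w = o then h ▸ s₀ else dflt w
  -- Each round of `next` recomputes every value from the parent's value in the previous round, and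
  -- a vertex at depth `n` is read off after `n` rounds. Starting from `next dflt` instead of `dflt`
  -- ensures that even the initial family takes the value `s₀` at `o`.
  let it : ℕ → ∀ w, S w := fun n => next^[n] (next dflt)
  have hit : ∀ n w, it (n + 1) w = next (it n) w := fun n w => by
    simp only [it, Function.iterate_succ_apply']
  have hit' : ∀ n w, ∃ st, it n w = next st w := by
    intro n w
    cases n with
    | zero => exact ⟨dflt, rfl⟩
    | succ n => exact ⟨_, hit n w⟩
  refine ⟨fun w => it (T.dist o w) w, ?_, ?_⟩
  · obtain ⟨st, hst⟩ := hit' (T.dist o o) o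
    dsimp only
    rw [hst]
    have : ¬ ∃ u, T.Adj u o ∧ T.dist o o = T.dist o u + 1 := by
      rintro ⟨u, -, h⟩
      rw [SimpleGraph.dist_self] at h
      omega
    simp only [next, this, dif_neg, not_false_eq_true, dif_pos]
  · intro u w huw hd
    have hex : ∃ u, T.Adj u w ∧ T.dist o w = T.dist o u + 1 := ⟨u, huw, hd⟩
    have hu : hex.choose = u :=
      hT.parent_unique hex.choose_spec.1 huw hex.choose_spec.2 hd
    have e : ∀ n, r hex.choose w (it n hex.choose) (it (n + 1) w) := by
      intro n
      rw [hit]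
      simp only [next]
      rw [dif_pos hex]
      exact (hr hex.choose w hex.choose_spec.1 (it n hex.choose)).choose_spec
    have e' := e (T.dist o u)
    rw [hu] at e'
    dsimp only
    rw [hd]
    exact e'

end Tree

/-! ### Trees of spaces and ladders. -/

/-- A tree of hyperbolic spaces inside an ambient space `X`: the vertex spaces are subsets `Xs v` of
`X` with their own metrics, and the edge spaces are the intersections of adjacent vertex spaces. -/
structure TreeOfSpaces {V : Type*} (T : SimpleGraph V) {X : Type*} (d : X → X → ℕ)
    (Xs : V → Set X) (dv : ∀ v, Xs v → Xs v → ℕ)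
    (de : ∀ u w, (Xs u ∩ Xs w : Set X) → (Xs u ∩ Xs w : Set X) → ℕ) (R δ K : ℕ) : Prop where
  vertex_geodesic : ∀ v, IsGeodesicDist (dv v)
  vertex_fourPoint : ∀ v, FourPoint (dv v) δ
  dist_le : ∀ v (x y : Xs v), d x y ≤ R * dv v x y
  edge_nonempty : ∀ u w, T.Adj u w → (Xs u ∩ Xs w).Nonempty
  edge_geodesic : ∀ u w, T.Adj u w → IsGeodesicDist (de u w)
  edge_left : ∀ u w, T.Adj u w →
    IsCoarseEmbedding (de u w) (dv u) (Set.inclusion Set.inter_subset_left) K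
  edge_right : ∀ u w, T.Adj u w →
    IsCoarseEmbedding (de u w) (dv w) (Set.inclusion Set.inter_subset_right) K
  linked : ∀ x u w, x ∈ Xs u → x ∈ Xs w →
    ∃ p : T.Walk u w, p.length ≤ R ∧ ∀ v ∈ p.support, x ∈ Xs v
  cover : ∀ x y, d x y ≤ 1 → ∃ v, ∃ (hx : x ∈ Xs v) (hy : y ∈ Xs v), dv v ⟨x, hx⟩ ⟨y, hy⟩ ≤ 1

namespace TreeOfSpaces

variable {V : Type*} {T : SimpleGraph V} {X : Type*} {d : X → X → ℕ} {Xs : V → Set X}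
  {dv : ∀ v, Xs v → Xs v → ℕ} {de : ∀ u w, (Xs u ∩ Xs w : Set X) → (Xs u ∩ Xs w : Set X) → ℕ}
  {R δ K : ℕ}

/-- The state of a ladder at a vertex `v`: the ends of the rung in `Xs v`, or the point to which all
of `Xs v` is retracted. -/
abbrev State (Xs : V → Set X) (v : V) : Type _ := (Xs v × Xs v) ⊕ X

/-- The rung of a ladder in the vertex space of `v`. -/
def rung (_ : TreeOfSpaces T d Xs dv de R δ K) (v : V) : State Xs v → Set X
  | .inl ab => {q | ∃ h : q ∈ Xs v, Between (dv v) ab.1 ab.2 ⟨q, h⟩}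
  | .inr _ => ∅

/-- The retraction of the vertex space of `v` to a ladder. -/
noncomputable def retr (t : TreeOfSpaces T d Xs dv de R δ K) (v : V) : State Xs v → Xs v → X
  | .inl ab, p => (t.vertex_geodesic v).proj ab.1 ab.2 p
  | .inr c, _ => c

/-- The states of a ladder at the ends of an edge `(u, w)`, with `w` farther from the root,
fit together. -/
structure Compatible (t : TreeOfSpaces T d Xs dv de R δ K) (C : ℕ) (u w : V) (s : State Xs u)
    (s' : State Xs w) : Prop where
  retr_close : ∀ (p : X) (hu : p ∈ Xs u) (hw : p ∈ Xs w),
    d (t.retr u s ⟨p, hu⟩) (t.retr w s' ⟨p, hw⟩) ≤ C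
  rung_close : ∀ q ∈ t.rung w s', ∃ q' ∈ t.rung u s, d q q' ≤ C
  dead : ∀ c, s' = .inr c → c ∈ t.rung u s ∨ s = .inr c

/-- The alternatives of `FourPoint.ladder_step` become the two kinds of state. When the edge space
projects near one point `c` of the rung, the ladder stops and everything beyond is retracted to `c`;
a stopped ladder stays stopped. -/
lemma exists_compatible (hd : IsGeodesicDist d) (t : TreeOfSpaces T d Xs dv de R δ K) {u w : V}
    (h : T.Adj u w) (s : State Xs u) :
    ∃ s', t.Compatible (2 * (R * stepConst δ K)) u w s s' := by
  rcases s with ⟨a, b⟩ | c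
  · have : Nonempty (Xs u ∩ Xs w : Set X) := (t.edge_nonempty u w h).to_subtype
    rcases (t.vertex_fourPoint u).ladder_step (t.edge_geodesic u w h) (t.vertex_geodesic u)
      (t.vertex_geodesic w) (t.vertex_fourPoint w) (t.edge_left u w h) (t.edge_right u w h) a b with
      ⟨c, hc, hc'⟩ | ⟨a', b', h1, h2⟩
    · refine ⟨.inr c, ⟨fun p hu hw => ?_, fun q hq => hq.elim, ?_⟩⟩
      · have h3 := (t.dist_le u _ _).trans (Nat.mul_le_mul_left R (hc' ⟨p, hu, hw⟩))
        have h4 : d (t.retr u (.inl (a, b)) ⟨p, hu⟩) c ≤ R * stepConst δ K := h3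
        exact h4.trans (by omega)
      · rintro _ ⟨⟩
        exact Or.inl ⟨c.2, hc⟩
    · refine ⟨.inl (Set.inclusion Set.inter_subset_right a', Set.inclusion Set.inter_subset_right b'),
        ⟨fun p hu hw => ?_, ?_, fun c hc => by cases hc⟩⟩
      · obtain ⟨s, hs, hs'⟩ := h1 ⟨p, hu, hw⟩
        have h3 := (t.dist_le u _ _).trans (Nat.mul_le_mul_left R hs)
        have h4 := (t.dist_le w _ _).trans (Nat.mul_le_mul_left R hs')
        have h5 := (hd.triangle _ _ _).trans (add_le_add h3 h4)
        rw [two_mul]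
        exact h5
      · rintro q ⟨hq, hq'⟩
        obtain ⟨s, hs, q', hq1, hq2⟩ := h2 ⟨q, hq⟩ hq'
        have h3 := (t.dist_le w _ _).trans (Nat.mul_le_mul_left R hs)
        have h4 := (t.dist_le u _ _).trans (Nat.mul_le_mul_left R hq2)
        refine ⟨q', ⟨q'.2, hq1⟩, ?_⟩
        rw [two_mul]
        exact (hd.triangle _ _ _).trans (add_le_add h3 h4)
  · exact ⟨.inr c, ⟨fun p hu hw => by simp [retr, hd.self], fun q hq => hq.elim,
      fun c' hc' => Or.inr (by cases hc'; rfl)⟩⟩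

/-- A ladder: a compatible choice of states, starting from a given geodesic in the vertex space of
the root. -/
structure IsLadder (t : TreeOfSpaces T d Xs dv de R δ K) (o : V) (st : ∀ v, State Xs v) : Prop where
  root : ∃ ab, st o = .inl ab
  step : ∀ u w, T.Adj u w → T.dist o w = T.dist o u + 1 →
    t.Compatible (2 * (R * stepConst δ K)) u w (st u) (st w)

/-- The union of the rungs of a ladder. -/
def ladder (t : TreeOfSpaces T d Xs dv de R δ K) (st : ∀ v, State Xs v) : Set X :=
  {q | ∃ v, q ∈ t.rung v (st v)}

lemma exists_isLadder (hd : IsGeodesicDist d) (hT : T.IsTree) (t : TreeOfSpaces T d Xs dv de R δ K)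
    (o : V) (x y : Xs o) : ∃ st, st o = .inl (x, y) ∧ t.IsLadder o st := by
  obtain ⟨st, h1, h2⟩ := hT.exists_family o (t.Compatible (2 * (R * stepConst δ K)))
    (fun u w h s => t.exists_compatible hd h s) (.inl (x, y))
  exact ⟨st, h1, ⟨⟨_, h1⟩, h2⟩⟩

variable {t : TreeOfSpaces T d Xs dv de R δ K} {o : V} {st : ∀ v, State Xs v}

/-- The point of a dead state is inherited unchanged from the last rung before the ladder stopped,
which exists because the root state is a rung. -/
lemma IsLadder.dead_mem (h : t.IsLadder o st) (hT : T.IsTree) :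
    ∀ n w, T.dist o w = n → ∀ c, st w = .inr c → c ∈ t.ladder st := by
  intro n
  induction n with
  | zero =>
    intro w hw c hc
    obtain rfl := hT.connected.dist_eq_zero_iff.1 hw
    obtain ⟨ab, hab⟩ := h.root
    rw [hab] at hc
    cases hc
  | succ n ih =>
    intro w hw c hc
    obtain ⟨u, hu, hn⟩ := hT.exists_parent o hw
    rcases (h.step u w hu (by omega)).dead c hc with h1 | h1
    · exact ⟨u, h1⟩
    · exact ih u hn c h1

lemma IsLadder.retr_mem (h : t.IsLadder o st) (hT : T.IsTree) (w : V) (p : Xs w) :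
    t.retr w (st w) p ∈ t.ladder st := by
  rcases hs : st w with ab | c
  · refine ⟨w, ?_⟩
    rw [hs]
    exact ⟨Subtype.coe_prop _, (t.vertex_geodesic w).between_proj _ _ _⟩
  · exact h.dead_mem hT _ w rfl c hs

lemma IsLadder.exists_root_near (h : t.IsLadder o st) (hd : IsGeodesicDist d) (hT : T.IsTree) :
    ∀ n w, T.dist o w = n → ∀ q ∈ t.rung w (st w),
      ∃ q' ∈ t.rung o (st o), d q q' ≤ n * (2 * (R * stepConst δ K)) := by
  intro n
  induction n with
  | zero =>
    intro w hw q hq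
    obtain rfl := hT.connected.dist_eq_zero_iff.1 hw
    exact ⟨q, hq, by rw [hd.self]; omega⟩
  | succ n ih =>
    intro w hw q hq
    obtain ⟨u, hu, hn⟩ := hT.exists_parent o hw
    obtain ⟨q₁, h1, h1'⟩ := (h.step u w hu (by omega)).rung_close q hq
    obtain ⟨q₂, h2, h2'⟩ := ih u hn q₁ h1
    refine ⟨q₂, h2, ?_⟩
    rw [Nat.succ_mul]
    have := hd.triangle q q₁ q₂
    omega

lemma IsLadder.retr_close_of_adj (h : t.IsLadder o st) (hd : IsGeodesicDist d) (hT : T.IsTree)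
    {u w : V} (huw : T.Adj u w) {p : X} (hu : p ∈ Xs u) (hw : p ∈ Xs w) :
    d (t.retr u (st u) ⟨p, hu⟩) (t.retr w (st w) ⟨p, hw⟩) ≤ 2 * (R * stepConst δ K) := by
  rcases hT.dist_eq_dist_add_one_of_adj o huw with h1 | h1
  · rw [hd.comm]
    exact (h.step w u huw.symm h1).retr_close p hw hu
  · exact (h.step u w huw h1).retr_close p hu hw

/-- This makes the retraction coarsely well defined on `X`: a walk supplied by `linked` stays in
vertex spaces containing `p`, and each of its edges costs a bounded error. -/
lemma IsLadder.retr_close (h : t.IsLadder o st) (hd : IsGeodesicDist d) (hT : T.IsTree)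
    {u w : V} {p : X} (hu : p ∈ Xs u) (hw : p ∈ Xs w) :
    d (t.retr u (st u) ⟨p, hu⟩) (t.retr w (st w) ⟨p, hw⟩) ≤ R * (2 * (R * stepConst δ K)) := by
  obtain ⟨c, hc, hc'⟩ := t.linked p u w hu hw
  refine le_trans ?_ (Nat.mul_le_mul_right _ hc)
  clear hc
  induction c with
  | nil => rw [hd.self]; omega
  | @cons u v w hadj c ih =>
    have hv : p ∈ Xs v := hc' v (by simp)
    have h1 := h.retr_close_of_adj hd hT hadj hu hv
    have h2 := ih hv hw fun x hx => hc' x (by simp [hx])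
    have h3 := hd.triangle (t.retr u (st u) ⟨p, hu⟩) (t.retr v (st v) ⟨p, hv⟩)
      (t.retr w (st w) ⟨p, hw⟩)
    rw [SimpleGraph.Walk.length_cons, Nat.succ_mul]
    omega

lemma retr_lipschitz (t : TreeOfSpaces T d Xs dv de R δ K) (hd : IsGeodesicDist d) (v : V)
    (s : State Xs v) (p q : Xs v) : d (t.retr v s p) (t.retr v s q) ≤ R * (dv v p q + 1 + δ) := by
  rcases s with ab | c
  · exact (t.dist_le v _ _).trans (Nat.mul_le_mul_left R
      ((t.vertex_geodesic v).proj_dist_le (t.vertex_fourPoint v) _ _ _ _))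
  · simp [retr, hd.self]

lemma retr_of_mem (t : TreeOfSpaces T d Xs dv de R δ K) {v : V} {s : State Xs v} {q : X}
    (hq : q ∈ t.rung v s) : ∃ h : q ∈ Xs v, d (t.retr v s ⟨q, h⟩) q ≤ R * (1 + δ) := by
  rcases s with ab | c
  · obtain ⟨h, hq⟩ := hq
    exact ⟨h, (t.dist_le v _ _).trans (Nat.mul_le_mul_left R
      ((t.vertex_geodesic v).proj_dist_self (t.vertex_fourPoint v) hq))⟩
  · exact hq.elim

/-- The Lipschitz constant of the retraction to a ladder. -/
noncomputable def ladderConst (R δ K : ℕ) : ℕ :=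
  2 * (R * (2 * (R * stepConst δ K))) + R * (2 + δ)

/-- The retractions of the vertex spaces glue to a coarsely Lipschitz map `ρ` onto the ladder that
almost fixes it. Its image of a geodesic is then an efficient chain inside the ladder. -/
lemma IsLadder.near_ladder (h : t.IsLadder o st) (hd : IsGeodesicDist d) (hT : T.IsTree) {δ' : ℕ}
    (h' : FourPoint d δ') {x y p : X} (hx : x ∈ t.ladder st) (hy : y ∈ t.ladder st)
    (hp : Between d x y p) : ∃ b ∈ t.ladder st, d p b ≤ detourConst δ' (ladderConst R δ K) 2 := by
  have hcov : ∀ x, ∃ v, x ∈ Xs v := fun x => by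
    obtain ⟨v, hx, -⟩ := t.cover x x (by rw [hd.self]; omega)
    exact ⟨v, hx⟩
  choose vs hvs using hcov
  let ρ : X → X := fun x => t.retr (vs x) (st (vs x)) ⟨x, hvs x⟩
  have hρB : ∀ x, ρ x ∈ t.ladder st := fun x => h.retr_mem hT _ _
  have hρ : ∀ x y, d x y ≤ 1 → d (ρ x) (ρ y) ≤ ladderConst R δ K := by
    intro x y hxy
    obtain ⟨v, hx, hy, hv⟩ := t.cover x y hxy
    have h1 := h.retr_close hd hT (hvs x) hx
    have h2 := h.retr_close hd hT hy (hvs y)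
    have h3 := (t.retr_lipschitz hd v (st v) ⟨x, hx⟩ ⟨y, hy⟩).trans
      (Nat.mul_le_mul_left R (show _ ≤ 2 + δ by omega))
    have h4 := hd.triangle (ρ x) (t.retr v (st v) ⟨x, hx⟩) (ρ y)
    have h5 := hd.triangle (t.retr v (st v) ⟨x, hx⟩) (t.retr v (st v) ⟨y, hy⟩) (ρ y)
    unfold ladderConst
    simp only [ρ] at *
    omega
  have hρid : ∀ q ∈ t.ladder st, d q (ρ q) ≤ ladderConst R δ K := by
    rintro q ⟨v, hq⟩
    obtain ⟨hqv, h1⟩ := t.retr_of_mem hq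
    have h2 := h.retr_close hd hT hqv (hvs q)
    have h3 := hd.triangle q (t.retr v (st v) ⟨q, hqv⟩) (ρ q)
    have h4 := hd.comm q (t.retr v (st v) ⟨q, hqv⟩)
    have h5 : R * (1 + δ) ≤ R * (2 + δ) := Nat.mul_le_mul_left R (by omega)
    unfold ladderConst
    simp only [ρ] at *
    omega
  refine h'.near_of_efficient hd (fun b₁ hb₁ b₂ hb₂ => ?_) hx hy hp
  obtain ⟨γ, h0, h1, hγ⟩ := hd.exists_geodesic b₁ b₂
  obtain ⟨n, hn⟩ : ∃ n, n = d b₁ b₂ := ⟨_, rfl⟩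
  rw [← hn] at h1 hγ
  -- The ends are added by hand because `ρ` moves them a little, so there are `n + 2 ≤ 2 * (n + 1)`
  -- steps; this is the `2` in the constant.
  refine ⟨fun i => if i = 0 then b₁ else if i ≤ n + 1 then ρ (γ (i - 1)) else b₂, n + 2,
    by omega, by simp, by simp, fun i hi => ?_, fun i hi => ?_⟩
  · dsimp only
    split_ifs
    exacts [hb₁, hρB _, hb₂]
  · dsimp only
    rw [if_neg (Nat.succ_ne_zero i)]
    rcases Nat.eq_zero_or_pos i with rfl | hi0
    · rw [if_pos rfl, if_pos (by omega)]
      simpa [h0] using hρid b₁ hb₁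
    · rw [if_neg hi0.ne', if_pos (by omega)]
      split_ifs with h2
      · refine hρ _ _ ?_
        rw [hγ _ _ (by omega) (by omega)]
        omega
      · rw [show i - 1 = n by omega, h1, hd.comm]
        exact hρid b₂ hb₂

/-- By `cover`, neighbours in `X` share a vertex space, and by `linked` the vertex spaces through
one point are at tree distance at most `R`. So each step from `x₀` costs at most `R`, with one more
`R` to reach an arbitrary `w` at the end. -/
lemma dist_root_le (t : TreeOfSpaces T d Xs dv de R δ K) (hd : IsGeodesicDist d) (hT : T.IsTree)
    {o : V} {x₀ : X} (ho : x₀ ∈ Xs o) : ∀ n x, d x₀ x = n → ∀ w, x ∈ Xs w →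
      T.dist o w ≤ R * (n + 1) := by
  have hl : ∀ x u w, x ∈ Xs u → x ∈ Xs w → T.dist u w ≤ R := fun x u w hu hw => by
    obtain ⟨p, hp, -⟩ := t.linked x u w hu hw
    exact (SimpleGraph.dist_le p).trans hp
  have hcov : ∀ n x, d x₀ x ≤ n → ∃ w, x ∈ Xs w ∧ T.dist o w ≤ R * n := by
    intro n
    induction n with
    | zero =>
      intro x hx
      obtain ⟨v, h1, h2, -⟩ := t.cover x₀ x (by omega)
      obtain ⟨γ, h0, h1', -⟩ := hd.exists_geodesic x₀ x
      rw [Nat.le_zero.1 hx, h0] at h1'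
      exact ⟨o, h1' ▸ ho, by simp⟩
    | succ n ih =>
      intro x hx
      rcases hx.lt_or_eq with hlt | heq
      · obtain ⟨w, hw, hw'⟩ := ih x (by omega)
        exact ⟨w, hw, hw'.trans (Nat.mul_le_mul_left R (Nat.le_succ n))⟩
      · obtain ⟨y, hy, hy'⟩ := hd.exists_between (a := x₀) (b := x) (n := n) (by omega)
        unfold Between at hy
        obtain ⟨w, hw, hw'⟩ := ih y hy'.le
        obtain ⟨v, h1, h2, -⟩ := t.cover y x (by omega)
        refine ⟨v, h2, ?_⟩
        have h3 := hl y w v hw h1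
        have h4 := hT.connected.dist_triangle (u := o) (v := w) (w := v)
        rw [Nat.mul_succ]
        omega
  intro n x hx w hw
  obtain ⟨v, hv, hv'⟩ := hcov n x hx.le
  have h3 := hl x v w hv hw
  have h4 := hT.connected.dist_triangle (u := o) (v := v) (w := w)
  rw [Nat.mul_succ]
  omega

/-- In a tree of hyperbolic spaces with hyperbolic total space, points of a vertex space with large
Gromov product in the vertex space have large Gromov product in the total space. -/
theorem gromov_product_large (t : TreeOfSpaces T d Xs dv de R δ K) (hd : IsGeodesicDist d)
    (hT : T.IsTree) {δ' : ℕ} (h' : FourPoint d δ') {o : V} (x₀ : Xs o)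
    (hproper : ∀ n, ∃ m, ∀ x : Xs o, d x₀ x ≤ n → dv o x₀ x ≤ m) (M : ℕ) :
    ∃ N, ∀ x y : Xs o, dv o x y + N ≤ dv o x x₀ + dv o y x₀ → d x y + M ≤ d x x₀ + d y x₀ := by
  obtain ⟨D, hD⟩ : ∃ D, D = detourConst δ' (ladderConst R δ K) 2 := ⟨_, rfl⟩
  obtain ⟨Q, hQ⟩ : ∃ Q, Q = M + (δ' + 1) + D := ⟨_, rfl⟩
  obtain ⟨m, hm⟩ := hproper (Q + R * (Q + 1) * (2 * (R * stepConst δ K)))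
  refine ⟨2 * m + 1, fun x y hxy => ?_⟩
  -- If the product in `X` is less than `M / 2`, the center of `x`, `y`, `x₀` on a geodesic from `x`
  -- to `y` is close to `x₀`, and a point `b` of the ladder is within `Q` of `x₀`.
  by_contra! hcon
  obtain ⟨st, hst, h⟩ := t.exists_isLadder hd hT o x y
  have hx : (x : X) ∈ t.ladder st := ⟨o, by
    rw [hst]; exact ⟨x.2, (t.vertex_geodesic o).between_left _ _⟩⟩
  have hy : (y : X) ∈ t.ladder st := ⟨o, by
    rw [hst]; exact ⟨y.2, (t.vertex_geodesic o).between_right _ _⟩⟩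
  have hc := hd.isCenter_proj h' x y x₀
  obtain ⟨b, ⟨w, hb⟩, hb'⟩ := h.near_ladder hd hT h' hx hy (hd.between_proj x y x₀)
  have hc1 := hc.ap
  have hc2 := hc.bp
  obtain ⟨c, hcdef⟩ : ∃ c, c = hd.proj x y x₀ := ⟨_, rfl⟩
  rw [← hcdef] at hc1 hc2 hb'
  rw [← hD] at hb'
  have t1 := hd.triangle x c y
  have s1 := hd.comm c y
  have s2 := hd.comm c x₀
  have t2 := hd.triangle x₀ c b
  have hbQ : d x₀ b ≤ Q := by omega
  have hbw : b ∈ Xs w := (t.retr_of_mem hb).1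
  have hwd := (t.dist_root_le hd hT x₀.2 _ b rfl w hbw).trans
    (Nat.mul_le_mul_left R (Nat.succ_le_succ hbQ))
  -- The rung of `b` has bounded depth, so `b` can be moved down to the root rung at bounded cost.
  -- The resulting `q` lies between `x` and `y` in `Xs o` and, by `hproper`, within `m` of `x₀`
  -- there, so the product in `Xs o` is at most `m`.
  obtain ⟨q, hq, hq'⟩ := h.exists_root_near hd hT _ w rfl b hb
  rw [hst] at hq
  obtain ⟨hqo, hq2⟩ := hq
  have hq3 := hq'.trans (Nat.mul_le_mul_right (2 * (R * stepConst δ K)) hwd)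
  have t3 := hd.triangle x₀ b q
  have hfin := hm ⟨q, hqo⟩ (by simp only []; simp only [Nat.succ_eq_add_one] at hq3; omega)
  have ho := t.vertex_geodesic o
  have u1 := ho.triangle x ⟨q, hqo⟩ x₀
  have u2 := ho.triangle y ⟨q, hqo⟩ x₀
  have u3 := ho.comm ⟨q, hqo⟩ x₀
  have u4 := ho.comm ⟨q, hqo⟩ y
  unfold Between at hq2
  simp only [] at hq2
  omega

end TreeOfSpaces

/-! ### Passing between graphs and their realizations; construction of rays. -/

lemma SimpleGraph.Connected.isGeodesicDist {V : Type*} {Γ : SimpleGraph V} (h : Γ.Connected) :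
    IsGeodesicDist Γ.dist where
  self x := SimpleGraph.dist_self
  comm x y := SimpleGraph.dist_comm
  triangle x y z := h.dist_triangle
  exists_geodesic x y := by
    obtain ⟨p, hp⟩ := h.exists_walk_length_eq_dist x y
    refine ⟨p.getVert, by simp, by rw [← hp]; simp, fun i j hij hj => ?_⟩
    rw [← hp] at hj
    have step : ∀ i k, i + k ≤ p.length → Γ.dist (p.getVert i) (p.getVert (i + k)) ≤ k := by
      intro i k
      induction k with
      | zero => intro _; simp
      | succ k ih =>
        intro hk
        have h1 := ih (by omega)
        have h2 := p.adj_getVert_succ (i := i + k) (by omega)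
        have h3 := h.dist_triangle (u := p.getVert i) (v := p.getVert (i + k))
          (w := p.getVert (i + k + 1))
        rw [SimpleGraph.dist_eq_one_iff_adj.2 h2] at h3
        rw [← add_assoc]
        omega
    have h1 := step 0 i (by omega)
    have h2 := step i (j - i) (by omega)
    have h3 := step j (p.length - j) (by omega)
    rw [show i + (j - i) = j by omega] at h2
    rw [show j + (p.length - j) = p.length by omega, SimpleGraph.Walk.getVert_length] at h3
    rw [zero_add, SimpleGraph.Walk.getVert_zero] at h1
    have t1 := h.dist_triangle (u := x) (v := p.getVert i) (w := y)
    have t2 := h.dist_triangle (u := p.getVert i) (v := p.getVert j) (w := y)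
    omega

section GromovProduct

variable {X : Type*} [MetricSpace X]

lemma gromovProduct_sub_le (a a' b b' c : X) :
    gromovProduct a' b' c - dist a a' - dist b b' ≤ gromovProduct a b c := by
  unfold gromovProduct
  have h1 := dist_triangle a' a c
  have h2 := dist_triangle b' b c
  have h3 := dist_triangle4 a a' b' b
  rw [dist_comm a' a] at h1
  rw [dist_comm b' b] at h2 h3
  linarith

lemma GeodesicRay.dist_eq {x₀ : X} (r : GeodesicRay X x₀) (s t : ℝ≥0) :
    dist (r.toFun s) (r.toFun t) = |(s : ℝ) - t| := by
  rw [r.isometry.dist_eq, NNReal.dist_eq]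

lemma GeodesicRay.dist_base {x₀ : X} (r : GeodesicRay X x₀) (t : ℝ≥0) :
    dist (r.toFun t) x₀ = t := by
  have h := r.dist_eq t 0
  rw [r.map_zero] at h
  simpa using h

lemma GeodesicRay.gromovProduct_eq {x₀ : X} (r : GeodesicRay X x₀) (s t : ℝ≥0) :
    gromovProduct (r.toFun s) (r.toFun t) x₀ = min (s : ℝ) t := by
  rw [gromovProduct, r.dist_base, r.dist_base, r.dist_eq]
  rcases le_total (s : ℝ) t with h | h
  · rw [min_eq_left h, abs_of_nonpos (by linarith)]; ring
  · rw [min_eq_right h, abs_of_nonneg (by linarith)]; ring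

end GromovProduct

namespace GeometricRealization

variable {V W : Type*} {Γ : SimpleGraph V} {Δ : SimpleGraph W} {hΓ : Γ.Connected}
  {hΔ : Δ.Connected}

lemma dist_mk_vertex_fst_le (p : EdgePoint Γ hΓ) :
    dist (SeparationQuotient.mk p : GeometricRealization Γ hΓ) (vertex hΓ p.fst) ≤ p.pos := by
  rw [vertex, SeparationQuotient.dist_mk, EdgePoint.dist_def]
  refine (EdgePoint.distance_le _ _ p.fst).trans ?_
  have h1 : p.toVertex p.fst ≤ p.pos := (min_le_left _ _).trans (by simp)
  have h2 : (⟨p.fst, p.fst, 0, Or.inl ⟨rfl, rfl⟩⟩ : EdgePoint Γ hΓ).toVertex p.fst ≤ 0 :=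
    (min_le_left _ _).trans (by simp)
  linarith

lemma dist_mk_vertex_snd_le (p : EdgePoint Γ hΓ) :
    dist (SeparationQuotient.mk p : GeometricRealization Γ hΓ) (vertex hΓ p.snd) ≤ 1 - p.pos := by
  rw [vertex, SeparationQuotient.dist_mk, EdgePoint.dist_def]
  refine (EdgePoint.distance_le _ _ p.snd).trans ?_
  have h1 : p.toVertex p.snd ≤ 1 - p.pos := (min_le_right _ _).trans (by simp)
  have h2 : (⟨p.snd, p.snd, 0, Or.inl ⟨rfl, rfl⟩⟩ : EdgePoint Γ hΓ).toVertex p.snd ≤ 0 :=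
    (min_le_left _ _).trans (by simp)
  linarith

lemma exists_dist_vertex_le (x : GeometricRealization Γ hΓ) :
    ∃ v, dist x (vertex hΓ v) ≤ 1 := by
  obtain ⟨p, rfl⟩ := SeparationQuotient.surjective_mk x
  exact ⟨p.fst, (dist_mk_vertex_fst_le p).trans p.pos_le_one⟩

lemma dist_vertex (u v : V) : dist (vertex hΓ u) (vertex hΓ v) = Γ.dist u v := by
  rw [vertex, vertex, SeparationQuotient.dist_mk, EdgePoint.dist_def]
  have hv : ∀ u v : V, (⟨u, u, 0, Or.inl ⟨rfl, rfl⟩⟩ : EdgePoint Γ hΓ).toVertex v = Γ.dist u v := by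
    intro u v
    rw [EdgePoint.toVertex]
    exact (min_eq_left (by linarith)).trans (zero_add _)
  refine le_antisymm ?_ ?_
  · refine (EdgePoint.distance_le _ _ v).trans ?_
    rw [hv, hv, SimpleGraph.dist_self]
    simp
  · have := EdgePoint.toVertex_le_distance_add (⟨u, u, 0, Or.inl ⟨rfl, rfl⟩⟩ : EdgePoint Γ hΓ)
      ⟨v, v, 0, Or.inl ⟨rfl, rfl⟩⟩ v
    rw [hv, hv, SimpleGraph.dist_self] at this
    simpa using this

lemma map_vertex (φ : Γ →g Δ) (v : V) : map hΓ hΔ φ (vertex hΓ v) = vertex hΔ (φ v) := rfl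

lemma dist_map_le (φ : Γ →g Δ) (x y : GeometricRealization Γ hΓ) :
    dist (map hΓ hΔ φ x) (map hΓ hΔ φ y) ≤ dist x y := by
  obtain ⟨p, rfl⟩ := SeparationQuotient.surjective_mk x
  obtain ⟨q, rfl⟩ := SeparationQuotient.surjective_mk y
  exact EdgePoint.dist_map_le φ p q

lemma continuous_map (φ : Γ →g Δ) : Continuous (map hΓ hΔ φ) :=
  (LipschitzWith.of_dist_le_mul (K := 1) fun x y => by simpa using dist_map_le φ x y).continuous

lemma gromovProduct_vertex (u v w : V) :
    gromovProduct (vertex hΓ u) (vertex hΓ v) (vertex hΓ w) =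
      ((Γ.dist u w : ℝ) + Γ.dist v w - Γ.dist u v) / 2 := by
  rw [gromovProduct, dist_vertex, dist_vertex, dist_vertex]

lemma exists_fourPoint (h : IsGromovHyperbolic (GeometricRealization Γ hΓ)) :
    ∃ δ, FourPoint Γ.dist δ := by
  obtain ⟨δ, hδ⟩ := h
  obtain ⟨n, hn⟩ := exists_nat_ge (2 * δ)
  refine ⟨n, fun x y z w => ?_⟩
  have h1 := hδ (vertex hΓ x) (vertex hΓ y) (vertex hΓ z) (vertex hΓ w)
  rw [gromovProduct_vertex, gromovProduct_vertex, gromovProduct_vertex] at h1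
  have h2 : ((Γ.dist x z + Γ.dist y w : ℕ) : ℝ) ≤
      (max (Γ.dist x y + Γ.dist z w) (Γ.dist x w + Γ.dist y z) + n : ℕ) := by
    push_cast
    rcases le_total (((Γ.dist x w : ℝ) + Γ.dist y w - Γ.dist x y) / 2)
      (((Γ.dist y w : ℝ) + Γ.dist z w - Γ.dist y z) / 2) with h | h
    · rw [min_eq_left h] at h1
      have := le_max_left ((Γ.dist x y : ℝ) + Γ.dist z w) (Γ.dist x w + Γ.dist y z)
      linarith
    · rw [min_eq_right h] at h1
      have := le_max_right ((Γ.dist x y : ℝ) + Γ.dist z w) (Γ.dist x w + Γ.dist y z)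
      linarith
  exact_mod_cast h2

lemma isGromovHyperbolic_of_fourPoint {δ : ℕ} (h : FourPoint Γ.dist δ) :
    IsGromovHyperbolic (GeometricRealization Γ hΓ) := by
  refine ⟨(δ + 12) / 2, fun x y z w => ?_⟩
  obtain ⟨x', hx⟩ := exists_dist_vertex_le x
  obtain ⟨y', hy⟩ := exists_dist_vertex_le y
  obtain ⟨z', hz⟩ := exists_dist_vertex_le z
  obtain ⟨w', hw⟩ := exists_dist_vertex_le w
  have approx : ∀ {a b : GeometricRealization Γ hΓ} {a' b' : V}, dist a (vertex hΓ a') ≤ 1 →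
      dist b (vertex hΓ b') ≤ 1 →
      dist a b ≤ Γ.dist a' b' + 2 ∧ (Γ.dist a' b' : ℝ) ≤ dist a b + 2 := by
    intro a b a' b' ha hb
    rw [← dist_vertex (hΓ := hΓ)]
    have h1 := dist_triangle4 a (vertex hΓ a') (vertex hΓ b') b
    have h2 := dist_triangle4 (vertex hΓ a') a b (vertex hΓ b')
    rw [dist_comm (vertex hΓ b')] at h1
    rw [dist_comm (vertex hΓ a') a] at h2
    constructor <;> linarith
  have h1 : ((Γ.dist x' z' + Γ.dist y' w' : ℕ) : ℝ) ≤
      (max (Γ.dist x' y' + Γ.dist z' w') (Γ.dist x' w' + Γ.dist y' z') + δ : ℕ) := by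
    exact_mod_cast h x' y' z' w'
  push_cast at h1
  have a1 := approx hx hz
  have a2 := approx hy hw
  have a3 := approx hx hy
  have a4 := approx hz hw
  have a5 := approx hx hw
  have a6 := approx hy hz
  have m1 := min_le_left (gromovProduct x y w) (gromovProduct y z w)
  have m2 := min_le_right (gromovProduct x y w) (gromovProduct y z w)
  rcases le_total ((Γ.dist x' y' : ℝ) + Γ.dist z' w') (Γ.dist x' w' + Γ.dist y' z') with hm | hm
  · rw [max_eq_right hm] at h1
    unfold gromovProduct at *
    linarith
  · rw [max_eq_left hm] at h1
    unfold gromovProduct at *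
    linarith

section Ray

variable {z : ℕ → V}

/-- A combinatorial geodesic ray of a graph gives a geodesic ray of its realization. -/
lemma exists_geodesicRay (hΓ : Γ.Connected) {v₀ : V} (h0 : z 0 = v₀)
    (hz : ∀ i j, i ≤ j → Γ.dist (z i) (z j) = j - i) :
    ∃ ρ : GeodesicRay (GeometricRealization Γ hΓ) (vertex hΓ v₀),
      ∀ n : ℕ, ρ.toFun n = vertex hΓ (z n) := by
  subst h0
  have hadj : ∀ i, Γ.Adj (z i) (z (i + 1)) := fun i => by
    rw [← SimpleGraph.dist_eq_one_iff_adj, hz i _ (Nat.le_succ i)]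
    omega
  let P : ℝ≥0 → EdgePoint Γ hΓ := fun t => ⟨z ⌊t⌋₊, z (⌊t⌋₊ + 1), t - ⌊t⌋₊, Or.inr ⟨hadj _, by
    have : ((⌊t⌋₊ : ℝ≥0) : ℝ) ≤ t := NNReal.coe_le_coe.2 (Nat.floor_le zero_le)
    push_cast at this
    linarith, by
    have : ((t : ℝ≥0) : ℝ) < ((⌊t⌋₊ + 1 : ℝ≥0) : ℝ) := NNReal.coe_lt_coe.2 (Nat.lt_floor_add_one t)
    push_cast at this
    linarith⟩⟩
  let f : ℝ≥0 → GeometricRealization Γ hΓ := fun t => SeparationQuotient.mk (P t)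
  have hfn : ∀ n : ℕ, f n = vertex hΓ (z n) := by
    intro n
    have h1 := dist_mk_vertex_fst_le (P n)
    have h2 : (P n).pos = 0 := by simp [P]
    have h3 : (P n).fst = z n := by simp [P]
    rw [h2, h3] at h1
    exact dist_le_zero.1 h1
  have hlip : ∀ s t : ℝ≥0, s ≤ t → dist (f s) (f t) ≤ t - s := by
    intro s t hst
    rcases (Nat.floor_mono hst).lt_or_eq with hlt | heq
    · have h1 : dist (f s) (vertex hΓ (z (⌊s⌋₊ + 1))) ≤ 1 - (s - ⌊s⌋₊) :=
        dist_mk_vertex_snd_le (P s)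
      have h2 : dist (f t) (vertex hΓ (z ⌊t⌋₊)) ≤ t - ⌊t⌋₊ := dist_mk_vertex_fst_le (P t)
      have h3 : dist (vertex hΓ (z (⌊s⌋₊ + 1))) (vertex hΓ (z ⌊t⌋₊)) = ⌊t⌋₊ - (⌊s⌋₊ + 1) := by
        rw [dist_vertex, hz _ _ hlt, Nat.cast_sub hlt]
        push_cast
        ring
      have h4 := dist_triangle4 (f s) (vertex hΓ (z (⌊s⌋₊ + 1))) (vertex hΓ (z ⌊t⌋₊)) (f t)
      rw [dist_comm (vertex hΓ (z ⌊t⌋₊)) (f t)] at h4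
      linarith
    · have h1 := EdgePoint.distance_le_of_eq (P s) (P t) (by simp [P, heq]) (by simp [P, heq])
      have h2 : dist (f s) (f t) = EdgePoint.distance (P s) (P t) := by
        simp only [f, SeparationQuotient.dist_mk, EdgePoint.dist_def]
      rw [h2]
      refine h1.trans (le_of_eq ?_)
      have hst' : (s : ℝ) ≤ t := hst
      simp only [P, heq]
      rw [abs_of_nonpos (by linarith)]
      ring
  -- The ends of `[0, ⌊t⌋₊ + 1]` are vertices at known distance, so none of the Lipschitz bounds on
  -- its three subintervals cut at `s` and `t` can be strict.
  have hiso : ∀ s t : ℝ≥0, s ≤ t → dist (f s) (f t) = t - s := by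
    intro s t hst
    refine le_antisymm (hlip s t hst) ?_
    have hn : t ≤ ((⌊t⌋₊ + 1 : ℕ) : ℝ≥0) := by
      push_cast
      exact (Nat.lt_floor_add_one t).le
    have h1 := hlip 0 s zero_le
    have h2 := hlip t _ hn
    have h3 : dist (f 0) (f ((⌊t⌋₊ + 1 : ℕ) : ℝ≥0)) = (⌊t⌋₊ + 1 : ℕ) := by
      rw [hfn, ← Nat.cast_zero (R := ℝ≥0), hfn, dist_vertex, hz _ _ (Nat.zero_le _), Nat.sub_zero]
    have h4 := dist_triangle4 (f 0) (f s) (f t) (f ((⌊t⌋₊ + 1 : ℕ) : ℝ≥0))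
    rw [NNReal.coe_zero] at h1
    rw [NNReal.coe_natCast] at h2
    linarith
  refine ⟨⟨f, Isometry.of_dist_eq fun s t => ?_, ?_⟩, hfn⟩
  · rw [NNReal.dist_eq]
    rcases le_total s t with h | h
    · rw [hiso s t h, abs_of_nonpos (by simpa using h)]; ring
    · rw [dist_comm, hiso t s h, abs_of_nonneg (by simpa using h)]
  · have := hfn 0
    simpa using this

/-- In a locally finite graph, a sequence that converges to a point at infinity is asymptotic to a
geodesic ray. -/
lemma exists_combinatorial_ray (hΓ : Γ.Connected) {δ : ℕ} (h : FourPoint Γ.dist δ) (v₀ : V)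
    (hfin : ∀ n, {v | Γ.dist v₀ v ≤ n}.Finite) (y : ℕ → V)
    (hy : ∀ M, ∃ N, ∀ k ≥ N, ∀ l ≥ N, Γ.dist (y k) (y l) + M ≤ Γ.dist v₀ (y k) + Γ.dist v₀ (y l)) :
    ∃ z : ℕ → V, z 0 = v₀ ∧ (∀ i j, i ≤ j → Γ.dist (z i) (z j) = j - i) ∧
      ∀ M, ∃ N, ∀ n ≥ N, ∀ k ≥ N,
        Γ.dist (z n) (y k) + M ≤ Γ.dist v₀ (z n) + Γ.dist v₀ (y k) := by
  have hd := hΓ.isGeodesicDist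
  choose γ g0 g1 hγ using fun k => hd.exists_geodesic v₀ (y k)
  have hlarge : ∀ M, ∃ N, ∀ k ≥ N, M ≤ Γ.dist v₀ (y k) := fun M => by
    obtain ⟨N, hN⟩ := hy (2 * M)
    refine ⟨N, fun k hk => ?_⟩
    have := hN k hk k hk
    rw [hd.self] at this
    omega
  -- A limit along an ultrafilter replaces the diagonal argument: balls are finite, so the `i`-th
  -- vertex of the geodesic to `y k` is constant for `𝒰`-almost all `k`.
  let 𝒰 : Ultrafilter ℕ := hyperfilter ℕ
  have h𝒰 : ∀ N : ℕ, ∀ᶠ k in (𝒰 : Filter ℕ), N ≤ k := fun N =>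
    Filter.Eventually.filter_mono (Nat.hyperfilter_le_atTop) (eventually_ge_atTop N)
  have hbtw : ∀ i, ∀ᶠ k in (𝒰 : Filter ℕ), i ≤ Γ.dist v₀ (y k) := fun i => by
    obtain ⟨N, hN⟩ := hlarge i
    exact (h𝒰 N).mono hN
  have hlim : ∀ i, ∃ v, ∀ᶠ k in (𝒰 : Filter ℕ), γ k i = v := by
    intro i
    have h1 : ∀ᶠ k in (𝒰 : Filter ℕ), ∃ v ∈ {v | Γ.dist v₀ v ≤ i}, γ k i = v := by
      refine (hbtw i).mono fun k hk => ⟨γ k i, ?_, rfl⟩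
      have := hγ k 0 i (Nat.zero_le _) hk
      rw [g0] at this
      simp only [Set.mem_ofPred_eq]
      omega
    obtain ⟨v, -, hv⟩ := (Ultrafilter.eventually_exists_mem_iff (hfin i)).1 h1
    exact ⟨v, hv⟩
  choose z hz using hlim
  have hz0 : z 0 = v₀ := by
    obtain ⟨k, hk⟩ := (hz 0).exists
    rw [← hk, g0]
  have hzz : ∀ i j, i ≤ j → Γ.dist (z i) (z j) = j - i := by
    intro i j hij
    obtain ⟨k, hk, hi, hj⟩ := ((hbtw j).and ((hz i).and (hz j))).exists
    rw [← hi, ← hj, hγ k i j hij hk]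
  refine ⟨z, hz0, hzz, fun M => ?_⟩
  obtain ⟨N, hN⟩ := hy (M + δ)
  refine ⟨max N (M + δ), fun n hn k hk => ?_⟩
  -- For such an `l`, the point `z n` lies on a geodesic from `v₀` to `y l`, so their Gromov product
  -- is `n`. That of `y l` and `y k` is large, and the four point condition gives the claim.
  obtain ⟨l, hl, hi, hl'⟩ := ((hbtw n).and ((hz n).and (h𝒰 N))).exists
  have h1 := hN k (by omega) l hl'
  have h2 := IsGeodesicDist.between_of_geodesic (g0 l) (g1 l) (hγ l) hl
  rw [hi] at h2
  unfold Between at h2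
  have h3 := hzz 0 n (Nat.zero_le _)
  rw [hz0] at h3
  have h4 := h (z n) (y l) (y k) v₀
  have c1 := hd.comm (y l) (y k)
  have c2 := hd.comm (y l) v₀
  have c3 := hd.comm (y k) v₀
  have c4 := hd.comm (z n) v₀
  omega

end Ray

end GeometricRealization

/-! ### Continuous extension to the Gromov compactifications. -/

namespace GeometricRealization

variable {V W : Type*} {Γ : SimpleGraph V} {Δ : SimpleGraph W} (hΓ : Γ.Connected)
  (hΔ : Δ.Connected) (φ : Γ →g Δ) (v₀ : V)

/-- Points with large Gromov product are mapped to points with large Gromov product. -/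
def PreservesLargeProducts : Prop :=
  ∀ M : ℕ, ∃ N : ℕ, ∀ x y, Γ.dist x y + N ≤ Γ.dist x v₀ + Γ.dist y v₀ →
    Δ.dist (φ x) (φ y) + M ≤ Δ.dist (φ x) (φ v₀) + Δ.dist (φ y) (φ v₀)

variable {φ v₀}

lemma PreservesLargeProducts.realization (h : PreservesLargeProducts φ v₀) (M : ℝ) :
    ∃ N : ℝ, ∀ x y, N ≤ gromovProduct x y (vertex hΓ v₀) →
      M ≤ gromovProduct (map hΓ hΔ φ x) (map hΓ hΔ φ y) (vertex hΔ (φ v₀)) := by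
  obtain ⟨m, hm⟩ := exists_nat_ge (2 * (M + 2))
  obtain ⟨n, hn⟩ := h m
  refine ⟨(n + 4) / 2, fun x y hxy => ?_⟩
  obtain ⟨x', hx⟩ := exists_dist_vertex_le x
  obtain ⟨y', hy⟩ := exists_dist_vertex_le y
  have h1 := gromovProduct_sub_le (vertex hΓ x') x (vertex hΓ y') y (vertex hΓ v₀)
  rw [gromovProduct_vertex, dist_comm _ x, dist_comm _ y] at h1
  have h2 : ((Γ.dist x' y' + n : ℕ) : ℝ) ≤ (Γ.dist x' v₀ + Γ.dist y' v₀ : ℕ) := by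
    push_cast
    linarith
  have h3 : ((Δ.dist (φ x') (φ y') + m : ℕ) : ℝ) ≤
      (Δ.dist (φ x') (φ v₀) + Δ.dist (φ y') (φ v₀) : ℕ) := by
    exact_mod_cast hn x' y' (by exact_mod_cast h2)
  push_cast at h3
  have h4 := gromovProduct_sub_le (map hΓ hΔ φ x) (map hΓ hΔ φ (vertex hΓ x')) (map hΓ hΔ φ y)
    (map hΓ hΔ φ (vertex hΓ y')) (vertex hΔ (φ v₀))
  have h5 := dist_map_le (hΔ := hΔ) φ x (vertex hΓ x')
  have h6 := dist_map_le (hΔ := hΔ) φ y (vertex hΓ y')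
  rw [map_vertex, map_vertex] at *
  rw [gromovProduct_vertex] at h4
  linarith

/-- The image of a geodesic ray converges to the end of a geodesic ray. -/
lemma PreservesLargeProducts.exists_ray (h : PreservesLargeProducts φ v₀) {δ : ℕ}
    (hδ : FourPoint Δ.dist δ) (hfin : ∀ n, {w | Δ.dist (φ v₀) w ≤ n}.Finite)
    (r : GeodesicRay (GeometricRealization Γ hΓ) (vertex hΓ v₀)) :
    ∃ ρ : GeodesicRay (GeometricRealization Δ hΔ) (vertex hΔ (φ v₀)), ∀ M : ℝ, ∀ᶠ t in atTop,
      M ≤ gromovProduct (ρ.toFun t) (map hΓ hΔ φ (r.toFun t)) (vertex hΔ (φ v₀)) := by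
  choose v hv using fun k : ℕ => exists_dist_vertex_le (r.toFun k)
  have hy : ∀ M, ∃ N, ∀ k ≥ N, ∀ l ≥ N, Δ.dist (φ (v k)) (φ (v l)) + M ≤
      Δ.dist (φ v₀) (φ (v k)) + Δ.dist (φ v₀) (φ (v l)) := by
    intro M
    obtain ⟨n, hn⟩ := h M
    refine ⟨n + 2, fun k hk l hl => ?_⟩
    rw [SimpleGraph.dist_comm (u := φ v₀), SimpleGraph.dist_comm (u := φ v₀)]
    apply hn
    have h1 := gromovProduct_sub_le (vertex hΓ (v k)) (r.toFun k) (vertex hΓ (v l)) (r.toFun l)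
      (vertex hΓ v₀)
    rw [gromovProduct_vertex, dist_comm _ (r.toFun k), dist_comm _ (r.toFun l),
      r.gromovProduct_eq] at h1
    have h2 : ((n + 2 : ℕ) : ℝ) ≤ min ((k : ℝ≥0) : ℝ) ((l : ℝ≥0) : ℝ) := by
      rw [NNReal.coe_natCast, NNReal.coe_natCast]
      exact le_min (by exact_mod_cast hk) (by exact_mod_cast hl)
    push_cast at h2
    have h3 := hv k
    have h4 := hv l
    have h5 : ((Γ.dist (v k) (v l) + n : ℕ) : ℝ) ≤ (Γ.dist (v k) v₀ + Γ.dist (v l) v₀ : ℕ) := by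
      push_cast at h1 ⊢
      have : (0 : ℝ) ≤ n := Nat.cast_nonneg n
      linarith
    exact_mod_cast h5
  obtain ⟨z, z0, hz, hzy⟩ := exists_combinatorial_ray hΔ hδ (φ v₀) hfin (fun k => φ (v k)) hy
  obtain ⟨ρ, hρ⟩ := exists_geodesicRay hΔ z0 hz
  refine ⟨ρ, fun M => ?_⟩
  obtain ⟨m, hm⟩ := exists_nat_ge (2 * (M + 3))
  obtain ⟨N, hN⟩ := hzy m
  filter_upwards [eventually_ge_atTop (N : ℝ≥0)] with t ht
  have hk : N ≤ ⌊t⌋₊ := Nat.le_floor ht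
  obtain ⟨k, hkdef⟩ : ∃ k, k = ⌊t⌋₊ := ⟨_, rfl⟩
  rw [← hkdef] at hk
  have hfl : |(t : ℝ) - ((k : ℝ≥0) : ℝ)| ≤ 1 := by
    have h1 : (k : ℝ≥0) ≤ t := hkdef ▸ Nat.floor_le zero_le
    have h2 : t < (k : ℝ≥0) + 1 := hkdef ▸ Nat.lt_floor_add_one t
    have h1' : ((k : ℝ≥0) : ℝ) ≤ t := h1
    have h2' : (t : ℝ) < ((k : ℝ≥0) : ℝ) + 1 := h2
    rw [abs_le]
    constructor <;> linarith
  have h1 := gromovProduct_sub_le (ρ.toFun t) (ρ.toFun k) (map hΓ hΔ φ (r.toFun t))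
    (map hΓ hΔ φ (vertex hΓ (v k))) (vertex hΔ (φ v₀))
  have h2 := dist_map_le (hΔ := hΔ) φ (r.toFun t) (vertex hΓ (v k))
  have h3 := dist_triangle (r.toFun t) (r.toFun k) (vertex hΓ (v k))
  have h4 := hv k
  rw [r.dist_eq] at h3
  rw [ρ.dist_eq, hρ, map_vertex, gromovProduct_vertex] at h1
  have h5 : ((Δ.dist (z k) (φ (v k)) + m : ℕ) : ℝ) ≤
      (Δ.dist (φ v₀) (z k) + Δ.dist (φ v₀) (φ (v k)) : ℕ) := by
    exact_mod_cast hN k hk k hk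
  push_cast at h5
  rw [map_vertex] at h2
  rw [SimpleGraph.dist_comm (u := z k) (v := φ v₀),
    SimpleGraph.dist_comm (u := φ (v k)) (v := φ v₀)] at h1
  linarith

open GromovCompactification in
/-- A graph map that preserves large Gromov products extends continuously to the Gromov
compactifications. -/
theorem PreservesLargeProducts.exists_continuous_extension (h : PreservesLargeProducts φ v₀) {δ : ℕ}
    (hδ : FourPoint Δ.dist δ) (hfin : ∀ n, {w | Δ.dist (φ v₀) w ≤ n}.Finite) :
    ∃ F : GromovCompactification (GeometricRealization Γ hΓ) (vertex hΓ v₀) →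
        GromovCompactification (GeometricRealization Δ hΔ) (vertex hΔ (φ v₀)),
      Continuous F ∧ ∀ x, F (.point x) = .point (map hΓ hΔ φ x) := by
  choose ray hray using h.exists_ray hΓ hΔ hδ hfin
  obtain ⟨ε, hε⟩ := isGromovHyperbolic_of_fourPoint (hΓ := hΔ) hδ
  let out : GromovBoundary (GeometricRealization Γ hΓ) (vertex hΓ v₀) →
    GeodesicRay (GeometricRealization Γ hΓ) (vertex hΓ v₀) := Quotient.out
  let F : GromovCompactification (GeometricRealization Γ hΓ) (vertex hΓ v₀) →
      GromovCompactification (GeometricRealization Δ hΔ) (vertex hΔ (φ v₀)) := fun a => match a with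
    | .point x => .point (map hΓ hΔ φ x)
    | .ideal ξ => .ideal (Quotient.mk _ (ray (out ξ)))
  have four : ∀ (M : ℝ) (a b c e : GeometricRealization Δ hΔ),
      M ≤ gromovProduct a b (vertex hΔ (φ v₀)) → M ≤ gromovProduct b c (vertex hΔ (φ v₀)) →
      M - ε ≤ gromovProduct a c (vertex hΔ (φ v₀)) := fun M a b c e h1 h2 =>
    (sub_le_sub_right (le_min h1 h2) ε).trans (hε a b c _)
  -- The chosen target ray attracts the image of every representative of `ξ`: representatives stay
  -- at bounded distance from `out ξ`, so their Gromov product at time `t` grows like `t`.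
  have follow : ∀ (ξ) (r : ℝ≥0 → GeometricRealization Γ hΓ), Represents r (.ideal ξ) → ∀ M : ℝ,
      ∀ᶠ t in atTop, M ≤ gromovProduct ((ray (out ξ)).toFun t) (map hΓ hΔ φ (r t))
        (vertex hΔ (φ v₀)) := by
    rintro ξ _ ⟨r, hr, rfl⟩ M
    obtain ⟨C, hC⟩ : ∃ C : ℝ, ∀ t, dist ((out ξ).toFun t) (r.toFun t) ≤ C := by
      have : Quotient.mk (GeodesicRay.setoid _ _) (out ξ) =
        Quotient.mk (GeodesicRay.setoid _ _) r := by rw [hr]; exact Quotient.out_eq ξ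
      exact Quotient.exact this
    obtain ⟨N, hN⟩ := h.realization hΓ hΔ (M + ε)
    filter_upwards [hray (out ξ) (M + ε), eventually_ge_atTop (Real.toNNReal (N + C))] with t h1 h2
    have h3 := gromovProduct_sub_le ((out ξ).toFun t) ((out ξ).toFun t) (r.toFun t)
      ((out ξ).toFun t) (vertex hΓ v₀)
    rw [(out ξ).gromovProduct_eq, min_self, dist_self, dist_comm (r.toFun t)] at h3
    have h4 : N + C ≤ t := Real.toNNReal_le_iff_le_coe.1 h2
    have h5 := hN ((out ξ).toFun t) (r.toFun t) (by have := hC t; linarith)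
    have := four _ _ _ _ (vertex hΔ (φ v₀)) h1 h5
    linarith
  -- Ordinary and ideal points are treated alike: the image of a representative of `a` can be
  -- replaced by a representative of `F a` at a cost of `ε` in Gromov products.
  have follow' : ∀ (a) (s : ℝ≥0 → GeometricRealization Γ hΓ), Represents s a →
      ∃ σ, Represents σ (F a) ∧ ∀ M : ℝ, ∀ᶠ t in atTop, ∀ b, M ≤ gromovProduct b
        (map hΓ hΔ φ (s t)) (vertex hΔ (φ v₀)) → M - ε ≤ gromovProduct b (σ t)
        (vertex hΔ (φ v₀)) := by
    rintro (x | ξ) s hs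
    · have hs' : s = fun _ => x := hs
      have hε0 : 0 ≤ ε := by
        have := hε (vertex hΔ (φ v₀)) (vertex hΔ (φ v₀)) (vertex hΔ (φ v₀)) (vertex hΔ (φ v₀))
        rw [min_self] at this
        linarith
      refine ⟨fun _ => map hΓ hΔ φ x, rfl, fun M => Eventually.of_forall fun t b hb => ?_⟩
      rw [hs'] at hb
      dsimp only at hb ⊢
      linarith
    · refine ⟨_, ⟨ray (out ξ), rfl, rfl⟩, fun M => ?_⟩
      filter_upwards [follow ξ s hs M] with t ht b hb
      have ht' : M ≤ gromovProduct (map hΓ hΔ φ (s t)) ((ray (out ξ)).toFun t)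
          (vertex hΔ (φ v₀)) := by
        refine ht.trans (le_of_eq ?_)
        unfold gromovProduct
        rw [dist_comm ((ray (out ξ)).toFun t) (map hΓ hΔ φ (s t))]
        ring
      exact four _ _ _ _ (vertex hΔ (φ v₀)) hb ht'
  refine ⟨F, continuous_def.2 fun U hU => ⟨?_, fun ξ hξ => ?_⟩, fun x => rfl⟩
  · exact hU.1.preimage (continuous_map φ)
  · obtain ⟨R, hR⟩ := hU.2 _ hξ
    -- Two replacements, of the images of `r` and of `s`, cost `ε` each; the `1` makes the final
    -- inequality strict.
    obtain ⟨N, hN⟩ := h.realization hΓ hΔ (R + 1 + 2 * ε)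
    refine ⟨N, ?_⟩
    rintro a ⟨r, s, hr, hs, hrs⟩
    obtain ⟨σ, hσ, hσ'⟩ := follow' a s hs
    refine hR ⟨_, σ, ⟨ray (out ξ), rfl, rfl⟩, hσ, ?_⟩
    filter_upwards [hrs, follow ξ r hr (R + 1 + 2 * ε), hσ' (R + 1 + ε)] with t h1 h2 h3
    have h4 := four _ _ _ _ (vertex hΔ (φ v₀)) h2 (hN _ _ h1.le)
    have h5 := h3 _ (by linarith)
    linarith

end GeometricRealization

/-- If the product of the images is small, geodesics between them pass near `f a`. Stability yields
`z` between `x` and `y` with `f z` near `f a`, and then `z` is near `a` by `lower`. -/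
lemma IsCoarseEmbedding.large_products {X Y : Type*} {dX : X → X → ℕ} {dY : Y → Y → ℕ} {f : X → Y}
    {δ K : ℕ} (hX : IsGeodesicDist dX) (hY : IsGeodesicDist dY) (h : FourPoint dY δ)
    (hf : IsCoarseEmbedding dX dY f K) (a : X) (M : ℕ) :
    ∃ N, ∀ x y, dX x y + N ≤ dX x a + dX y a →
      dY (f x) (f y) + M ≤ dY (f x) (f a) + dY (f y) (f a) := by
  obtain ⟨Q, hQ⟩ : ∃ Q, Q = M + (δ + 1) + morseConst δ K := ⟨_, rfl⟩
  refine ⟨2 * (K * Q + K) + 1, fun x y hxy => ?_⟩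
  by_contra! hcon
  have hc := hY.isCenter_proj h (f x) (f y) (f a)
  obtain ⟨z, hz, hz'⟩ := hf.exists_between_near hX hY h (hY.between_proj (f x) (f y) (f a))
  have hc1 := hc.ap
  have hc2 := hc.bp
  obtain ⟨c, hcdef⟩ : ∃ c, c = hY.proj (f x) (f y) (f a) := ⟨_, rfl⟩
  rw [← hcdef] at hc1 hc2 hz'
  have t1 := hY.triangle (f x) c (f y)
  have s1 := hY.comm c (f y)
  have s2 := hY.comm c (f a)
  have t2 := hY.triangle (f a) c (f z)
  have h1 := (hf.lower a z).trans (Nat.add_le_add_right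
    (Nat.mul_le_mul_left K (show _ ≤ Q by omega)) K)
  have u1 := hX.triangle x z a
  have u2 := hX.triangle y z a
  have u3 := hX.comm z a
  have u4 := hX.comm z y
  unfold Between at hz
  omega

lemma SimpleGraph.Connected.lipschitz_of_adj {V Y : Type*} {Γ : SimpleGraph V} (h : Γ.Connected)
    {d : Y → Y → ℕ} (hd : IsGeodesicDist d) (f : V → Y) (C : ℕ)
    (hf : ∀ x y, Γ.Adj x y → d (f x) (f y) ≤ C) (x y : V) : d (f x) (f y) ≤ C * Γ.dist x y := by
  obtain ⟨p, hp⟩ := h.exists_walk_length_eq_dist x y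
  rw [← hp]
  clear hp
  induction p with
  | nil => simp [hd.self]
  | @cons u v w huv p ih =>
    have h1 := hd.triangle (f u) (f v) (f w)
    have h2 := hf u v huv
    rw [SimpleGraph.Walk.length_cons, Nat.mul_succ]
    omega

lemma SimpleGraph.Iso.dist_eq {V W : Type*} {Γ : SimpleGraph V} {Δ : SimpleGraph W} (e : Γ ≃g Δ)
    (hΓ : Γ.Connected) (x y : V) : Δ.dist (e x) (e y) = Γ.dist x y := by
  have hΔ : Δ.Connected := e.connected_iff.1 hΓ
  refine le_antisymm ?_ ?_
  · exact_mod_cast EdgePoint.graph_dist_map_le hΓ e.toHom x y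
  · have : (Γ.dist (e.symm (e x)) (e.symm (e y)) : ℝ) ≤ Δ.dist (e x) (e y) :=
      EdgePoint.graph_dist_map_le hΔ e.symm.toHom (e x) (e y)
    simpa using this

lemma Set.Finite.exists_nat_bound {α : Type*} {s : Set α} (hs : s.Finite) (f : α → ℕ) :
    ∃ m, ∀ x ∈ s, f x ≤ m := by
  obtain ⟨m, hm⟩ := (hs.image f).bddAbove
  exact ⟨m, fun x hx => hm ⟨x, hx, rfl⟩⟩

/-! ### Word metrics of finitely generated groups. -/

section Cayley

variable {G : Type*} [Group G] {A : Set G}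

lemma cayley_dist_mul_left (hA : Subgroup.closure A = ⊤) (g x y : G) :
    (SimpleGraph.mulCayley A).dist (g * x) (g * y) = (SimpleGraph.mulCayley A).dist x y := by
  let e : SimpleGraph.mulCayley A ≃g SimpleGraph.mulCayley A :=
    { toEquiv := Equiv.mulLeft g
      map_rel_iff' := by simp [SimpleGraph.mulCayley_adj_mul_iff_right] }
  exact e.dist_eq (mulCayley_connected hA) x y

lemma cayley_dist_eq (hA : Subgroup.closure A = ⊤) (x y : G) :
    (SimpleGraph.mulCayley A).dist x y = (SimpleGraph.mulCayley A).dist 1 (x⁻¹ * y) := by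
  rw [← cayley_dist_mul_left hA x 1, mul_one, mul_inv_cancel_left]

lemma cayley_finite_ball (hA : Subgroup.closure A = ⊤) (hf : A.Finite) (n : ℕ) :
    {g | (SimpleGraph.mulCayley A).dist 1 g ≤ n}.Finite := by
  have hd := (mulCayley_connected hA).isGeodesicDist
  induction n with
  | zero =>
    refine (Set.finite_singleton (1 : G)).subset fun g hg => ?_
    exact ((mulCayley_connected hA).dist_eq_zero_iff.1 (Nat.le_zero.1 hg)).symm
  | succ n ih =>
    refine (ih.union (Set.Finite.image2 (· * ·) ih (hf.union hf.inv))).subset fun g hg => ?_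
    have hg' : (SimpleGraph.mulCayley A).dist 1 g ≤ n + 1 := hg
    rcases hg'.lt_or_eq with h | h
    · exact Or.inl (Nat.lt_succ_iff.1 h)
    · obtain ⟨p, hp, hp'⟩ := hd.exists_between (a := 1) (b := g) (n := n) (by omega)
      unfold Between at hp
      have h1 : (SimpleGraph.mulCayley A).dist p g = 1 := by omega
      rw [SimpleGraph.dist_eq_one_iff_adj, SimpleGraph.mulCayley_adj] at h1
      refine Or.inr ⟨p, hp'.le, p⁻¹ * g, ?_, by simp⟩
      rcases h1.2 with h2 | h2
      · exact Or.inl h2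
      · exact Or.inr (by simpa using h2)

/-- The word metrics of finite generating sets are Lipschitz equivalent. -/
lemma cayley_lipschitz (hA : Subgroup.closure A = ⊤) (hf : A.Finite) {B : Set G}
    (hB : Subgroup.closure B = ⊤) : ∃ C, ∀ x y,
      (SimpleGraph.mulCayley B).dist x y ≤ C * (SimpleGraph.mulCayley A).dist x y := by
  obtain ⟨C, hC⟩ := hf.exists_nat_bound fun s => (SimpleGraph.mulCayley B).dist 1 s
  refine ⟨C, (mulCayley_connected hA).lipschitz_of_adj (mulCayley_connected hB).isGeodesicDist id C
    fun x y hxy => ?_⟩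
  rw [SimpleGraph.mulCayley_adj] at hxy
  rcases hxy.2 with h | h
  · exact (cayley_dist_eq hB x y).trans_le (hC _ h)
  · exact (SimpleGraph.dist_comm.trans (cayley_dist_eq hB y x)).trans_le (hC _ h)

lemma IsHyperbolicGroup.exists_fourPoint (h : IsHyperbolicGroup G) (hA : Subgroup.closure A = ⊤)
    (hf : A.Finite) : ∃ δ, FourPoint (SimpleGraph.mulCayley A).dist δ := by
  obtain ⟨S, hS, hSf, hS'⟩ := h
  obtain ⟨δ, hδ⟩ := GeometricRealization.exists_fourPoint hS'
  obtain ⟨C, hC⟩ := cayley_lipschitz hA hf hS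
  obtain ⟨C', hC'⟩ := cayley_lipschitz hS hSf hA
  have hid : IsCoarseEmbedding (SimpleGraph.mulCayley A).dist (SimpleGraph.mulCayley S).dist id
      (C + C') :=
    ⟨fun x y => (hC x y).trans (Nat.mul_le_mul_right _ (by omega)), fun x y =>
      ((hC' x y).trans (Nat.mul_le_mul_right _ (Nat.le_add_left _ _))).trans (Nat.le_add_right _ _)⟩
  exact ⟨_, hid.fourPoint (mulCayley_connected hA).isGeodesicDist
    (mulCayley_connected hS).isGeodesicDist hδ⟩

lemma IsQuasiIsometricEmbedding.exists_isCoarseEmbedding {B : Type*} [Group B] {f : G →* B}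
    (h : IsQuasiIsometricEmbedding f) : ∃ (S : Set G) (T : Set B), S.Finite ∧ T.Finite ∧
      Subgroup.closure S = ⊤ ∧ Subgroup.closure T = ⊤ ∧ ∃ K,
        IsCoarseEmbedding (SimpleGraph.mulCayley S).dist (SimpleGraph.mulCayley T).dist f K := by
  obtain ⟨S, T, hSf, hTf, hS, hT, K, ε, hK, hε, hf⟩ := h
  obtain ⟨N, hN⟩ := exists_nat_ge (K + ε + K * ε)
  have hKε : 0 ≤ K * ε := by positivity
  refine ⟨S, T, hSf, hTf, hS, hT, N, fun x y => ?_, fun x y => ?_⟩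
  · by_cases hxy : x = y
    · subst hxy; simp
    · have h1 : (1 : ℝ) ≤ (SimpleGraph.mulCayley S).dist x y := by
        exact_mod_cast (mulCayley_connected hS).pos_dist_of_ne hxy
      have h2 := (hf x y).2
      unfold wordDist at h2
      have h3 : (((SimpleGraph.mulCayley T).dist (f x) (f y) : ℕ) : ℝ) ≤
          (N * (SimpleGraph.mulCayley S).dist x y : ℕ) := by
        push_cast
        nlinarith
      exact_mod_cast h3
  · have h2 := (hf x y).1
    unfold wordDist at h2
    have h4 : (0 : ℝ) ≤ (SimpleGraph.mulCayley T).dist (f x) (f y) := Nat.cast_nonneg _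
    have h3 : (((SimpleGraph.mulCayley S).dist x y : ℕ) : ℝ) ≤
        (N * (SimpleGraph.mulCayley T).dist (f x) (f y) + N : ℕ) := by
      push_cast
      rw [one_div, sub_le_iff_le_add, inv_mul_le_iff₀ (by linarith)] at h2
      nlinarith
    exact_mod_cast h3

end Cayley

/-! ### Rips graphs of subsets of a group. -/

section Rips

variable {G : Type*} [Group G]

/-- The graph on `G` in which points of word distance at most `R` are joined. -/
def ripsGraph (A : Set G) (R : ℕ) : SimpleGraph G where
  Adj x y := x ≠ y ∧ (SimpleGraph.mulCayley A).dist x y ≤ R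
  symm := ⟨fun _ _ h => ⟨h.1.symm, SimpleGraph.dist_comm.trans_le h.2⟩⟩
  loopless := ⟨fun _ h => h.1 rfl⟩

/-- The path metric of the Rips graph of a subset of `G`. -/
noncomputable def ripsDist (A : Set G) (R : ℕ) (Y : Set G) (x y : Y) : ℕ :=
  ((ripsGraph A R).induce Y).dist x y

/-- The inclusion of `Y` into `Z` is a quasi-isometric embedding of Rips graphs. -/
def RipsEmbeds (A : Set G) (R : ℕ) (Y Z : Set G) (K : ℕ) : Prop :=
  ∃ h : Y ⊆ Z, IsCoarseEmbedding (ripsDist A R Y) (ripsDist A R Z) (Set.inclusion h) K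

variable {A : Set G} {R : ℕ} {Y Z : Set G}

lemma isGeodesicDist_rips (h : ((ripsGraph A R).induce Y).Connected) :
    IsGeodesicDist (ripsDist A R Y) := h.isGeodesicDist

lemma rips_adj {x y : Y} : ((ripsGraph A R).induce Y).Adj x y ↔
    (x : G) ≠ y ∧ (SimpleGraph.mulCayley A).dist (x : G) y ≤ R := Iff.rfl

lemma rips_reachable {x y : Y} (h : (SimpleGraph.mulCayley A).dist (x : G) y ≤ R) :
    ((ripsGraph A R).induce Y).Reachable x y := by
  by_cases hxy : x = y
  · rw [hxy]
  · exact SimpleGraph.Adj.reachable (rips_adj.2 ⟨fun h => hxy (Subtype.ext h), h⟩)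

lemma ripsDist_le_one {x y : Y} (h : (SimpleGraph.mulCayley A).dist (x : G) y ≤ R) :
    ripsDist A R Y x y ≤ 1 := by
  by_cases hxy : x = y
  · rw [hxy, ripsDist, SimpleGraph.dist_self]; omega
  · exact (SimpleGraph.dist_eq_one_iff_adj.2
      (rips_adj.2 ⟨fun h => hxy (Subtype.ext h), h⟩)).le

lemma dist_le_ripsDist (hA : Subgroup.closure A = ⊤) (h : ((ripsGraph A R).induce Y).Connected)
    (x y : Y) : (SimpleGraph.mulCayley A).dist (x : G) y ≤ R * ripsDist A R Y x y :=
  h.lipschitz_of_adj (mulCayley_connected hA).isGeodesicDist (fun y : Y => (y : G)) R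
    (fun _ _ h => (rips_adj.1 h).2) x y

/-- A finitely generated subgroup is quasi-isometric to the Rips graphs of the sets that it
acts on with finitely many orbits. -/
lemma eventually_rips_of_subgroup (hA : Subgroup.closure A = ⊤) (hf : A.Finite) {L : Subgroup G}
    {S : Set L} (hS : Subgroup.closure S = ⊤) (hSf : S.Finite) (hLY : ∀ k : L, (k : G) ∈ Y)
    {E : Set G} (hE : E.Finite) (hYE : ∀ y ∈ Y, ∃ k : L, (k : G)⁻¹ * y ∈ E) :
    ∀ᶠ R in atTop, ((ripsGraph A R).induce Y).Connected ∧ ∃ C,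
      IsCoarseEmbedding (SimpleGraph.mulCayley S).dist (ripsDist A R Y) (fun k => ⟨k, hLY k⟩) C ∧
      ∃ ρ : Y → L, IsCoarseEmbedding (ripsDist A R Y) (SimpleGraph.mulCayley S).dist ρ C ∧
        ∀ y : Y, (SimpleGraph.mulCayley A).dist (ρ y : G) y ≤ R := by
  have hd := (mulCayley_connected hA).isGeodesicDist
  have hdS := (mulCayley_connected hS).isGeodesicDist
  obtain ⟨m₁, h₁⟩ := hSf.exists_nat_bound fun s => (SimpleGraph.mulCayley A).dist 1 (s : G)
  obtain ⟨m₂, h₂⟩ := hE.exists_nat_bound fun s => (SimpleGraph.mulCayley A).dist 1 s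
  -- At this scale `R` the Rips graph contains the `S`-edges of `L`, of length at most `m₁` in `G`,
  -- and joins each point of `Y` to its `ρ`-image, at distance at most `m₂`.
  filter_upwards [eventually_ge_atTop (m₁ + m₂)] with R hR
  choose ρ' hρ' using hYE
  let ρ : Y → L := fun y => ρ' y y.2
  let ι : L → Y := fun k => ⟨k, hLY k⟩
  have hρ : ∀ y : Y, (SimpleGraph.mulCayley A).dist (ρ y : G) y ≤ m₂ := fun y => by
    rw [cayley_dist_eq hA]
    exact h₂ _ (hρ' y y.2)
  have hstep : ∀ k k' : L, (SimpleGraph.mulCayley S).Adj k k' →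
      (SimpleGraph.mulCayley A).dist (k : G) k' ≤ m₁ := by
    intro k k' hk
    rw [SimpleGraph.mulCayley_adj] at hk
    rcases hk.2 with h | h
    · rw [cayley_dist_eq hA]; exact h₁ _ h
    · rw [SimpleGraph.dist_comm, cayley_dist_eq hA]; exact h₁ _ h
  have hconL : ∀ k k' : L, ((ripsGraph A R).induce Y).Reachable (ι k) (ι k') := by
    intro k k'
    obtain ⟨p⟩ := (mulCayley_connected hS).preconnected k k'
    induction p with
    | nil => rfl
    | @cons u v w huv p ih =>
      exact (rips_reachable (x := ι u) (y := ι v) ((hstep u v huv).trans (by omega))).trans ih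
  have hconρ : ∀ y : Y, ((ripsGraph A R).induce Y).Reachable (ι (ρ y)) y := fun y =>
    rips_reachable ((hρ y).trans (by omega))
  have hcon : ((ripsGraph A R).induce Y).Connected :=
    (SimpleGraph.connected_iff _).2
      ⟨fun x y => (hconρ x).symm.trans ((hconL _ _).trans (hconρ y)), ⟨ι 1⟩⟩
  have hdY := isGeodesicDist_rips hcon
  have hι : ∀ k k' : L, ripsDist A R Y (ι k) (ι k') ≤ 1 * (SimpleGraph.mulCayley S).dist k k' :=
    (mulCayley_connected hS).lipschitz_of_adj hdY ι 1 fun k k' hk =>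
      ripsDist_le_one (Y := Y) ((hstep k k' hk).trans (by omega))
  -- Only finitely many elements of `L` lie in a given ball of `G`, so bounded distance in `G`
  -- implies bounded distance in `L`. This uniform properness needs no assumption on the distortion
  -- of `L`.
  obtain ⟨C, hC⟩ : ∃ C, ∀ k k' : L, (SimpleGraph.mulCayley A).dist (k : G) k' ≤ R + 2 * m₂ →
      (SimpleGraph.mulCayley S).dist k k' ≤ C := by
    have hfin : {k : L | (SimpleGraph.mulCayley A).dist 1 (k : G) ≤ R + 2 * m₂}.Finite :=
      (cayley_finite_ball hA hf (R + 2 * m₂)).preimage Subtype.val_injective.injOn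
    obtain ⟨C, hC⟩ := hfin.exists_nat_bound fun k => (SimpleGraph.mulCayley S).dist 1 k
    refine ⟨C, fun k k' hk => ?_⟩
    rw [cayley_dist_eq hS]
    refine hC _ ?_
    rw [cayley_dist_eq hA] at hk
    exact hk
  have hρlip : ∀ y y' : Y, (SimpleGraph.mulCayley S).dist (ρ y) (ρ y') ≤ C * ripsDist A R Y y y' :=
    hcon.lipschitz_of_adj hdS ρ C fun y y' hyy => hC _ _ <| by
      have h1 := hd.triangle (ρ y : G) y (ρ y')
      have h2 := hd.triangle (y : G) y' (ρ y')
      have h3 := hd.comm (y' : G) (ρ y')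
      have h4 := hρ y
      have h5 := hρ y'
      have h6 := (rips_adj.1 hyy).2
      omega
  refine ⟨hcon, 2 * C + 2, ⟨fun k k' => (hι k k').trans (Nat.mul_le_mul_right _ (by omega)),
    fun k k' => ?_⟩, ρ, ⟨fun y y' => (hρlip y y').trans (Nat.mul_le_mul_right _ (by omega)),
    fun y y' => ?_⟩, fun y => (hρ y).trans (by omega)⟩
  · have h1 := hρlip (ι k) (ι k')
    have near : ∀ k : L, (SimpleGraph.mulCayley S).dist k (ρ (ι k)) ≤ C := fun k => hC _ _ <| by
      have := hρ (ι k)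
      rw [SimpleGraph.dist_comm]
      exact this.trans (by omega)
    have h2 := near k
    have h3 := near k'
    have h4 := hdS.triangle k (ρ (ι k)) k'
    have h5 := hdS.triangle (ρ (ι k)) (ρ (ι k')) k'
    have h6 := hdS.comm k' (ρ (ι k'))
    have h7 : C * ripsDist A R Y (ι k) (ι k') ≤ (2 * C + 2) * ripsDist A R Y (ι k) (ι k') :=
      Nat.mul_le_mul_right _ (by omega)
    change _ ≤ (2 * C + 2) * ripsDist A R Y (ι k) (ι k') + (2 * C + 2)
    omega
  · have h1 := hι (ρ y) (ρ y')
    have near : ∀ y : Y, ripsDist A R Y (ι (ρ y)) y ≤ 1 := fun y =>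
      ripsDist_le_one ((hρ y).trans (by omega))
    have h2 := near y
    have h3 := near y'
    have h4 := hdY.triangle y (ι (ρ y)) y'
    have h5 := hdY.triangle (ι (ρ y)) (ι (ρ y')) y'
    have h6 := hdY.comm y (ι (ρ y))
    have h7 : (SimpleGraph.mulCayley S).dist (ρ y) (ρ y') ≤
        (2 * C + 2) * (SimpleGraph.mulCayley S).dist (ρ y) (ρ y') :=
      Nat.le_mul_of_pos_left _ (by omega)
    omega

/-- Left translation as an isomorphism of Rips graphs. -/
def ripsIso (hA : Subgroup.closure A = ⊤) (R : ℕ) (g : G) (h : ∀ x, x ∈ Y ↔ g * x ∈ Z) :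
    (ripsGraph A R).induce Y ≃g (ripsGraph A R).induce Z where
  toFun x := ⟨g * x, (h x).1 x.2⟩
  invFun z := ⟨g⁻¹ * z, (h _).2 (by simp)⟩
  left_inv x := by simp
  right_inv z := by simp
  map_rel_iff' {x y} := by
    change (g * (x : G) ≠ g * y ∧ (SimpleGraph.mulCayley A).dist (g * (x : G)) (g * y) ≤ R) ↔ _
    rw [rips_adj, cayley_dist_mul_left hA, Ne, mul_right_inj]

lemma ripsDist_translate (hA : Subgroup.closure A = ⊤) (g : G) (h : ∀ x, x ∈ Y ↔ g * x ∈ Z)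
    (hY : ((ripsGraph A R).induce Y).Connected) (x y : Y) :
    ripsDist A R Z ⟨g * x, (h x).1 x.2⟩ ⟨g * y, (h y).1 y.2⟩ = ripsDist A R Y x y :=
  (ripsIso hA R g h).dist_eq hY x y

lemma rips_connected_translate (hA : Subgroup.closure A = ⊤) (g : G) (h : ∀ x, x ∈ Y ↔ g * x ∈ Z)
    (hZ : ((ripsGraph A R).induce Z).Connected) : ((ripsGraph A R).induce Y).Connected :=
  (ripsIso hA R g h).connected_iff.2 hZ

lemma fourPoint_translate (hA : Subgroup.closure A = ⊤) (g : G) (h : ∀ x, x ∈ Y ↔ g * x ∈ Z)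
    (hZ : ((ripsGraph A R).induce Z).Connected) {δ : ℕ} (hδ : FourPoint (ripsDist A R Z) δ) :
    FourPoint (ripsDist A R Y) δ := by
  have hY := rips_connected_translate hA g h hZ
  intro x y z w
  simp only [← ripsDist_translate hA g h hY]
  exact hδ _ _ _ _

lemma ripsEmbeds_translate (hA : Subgroup.closure A = ⊤) (g : G) {Y' Z' : Set G}
    (h : ∀ x, x ∈ Y ↔ g * x ∈ Z) (h' : ∀ x, x ∈ Y' ↔ g * x ∈ Z')
    (hZ : ((ripsGraph A R).induce Z).Connected) (hZ' : ((ripsGraph A R).induce Z').Connected)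
    {K : ℕ} (hK : RipsEmbeds A R Z Z' K) : RipsEmbeds A R Y Y' K := by
  obtain ⟨hs, hK⟩ := hK
  have hY := rips_connected_translate hA g h hZ
  have hY' := rips_connected_translate hA g h' hZ'
  have hsub : Y ⊆ Y' := fun x hx => (h' x).2 (hs ((h x).1 hx))
  refine ⟨hsub, fun x y => ?_, fun x y => ?_⟩
  · rw [← ripsDist_translate hA g h hY, ← ripsDist_translate hA g h' hY']
    exact hK.upper ⟨g * x, (h x).1 x.2⟩ ⟨g * y, (h y).1 y.2⟩
  · rw [← ripsDist_translate hA g h hY, ← ripsDist_translate hA g h' hY']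
    exact hK.lower ⟨g * x, (h x).1 x.2⟩ ⟨g * y, (h y).1 y.2⟩

/-- One element of `Y` is chosen for each value of `θ`. In the applications `θ` records the vertices
to which `y⁻¹` moves the given ones, and its fibres lie in single cosets of the stabilizer. -/
lemma exists_finite_representatives {α : Type*} (L : Subgroup G) (Y : Set G) (θ : G → α)
    (hfin : (θ '' Y).Finite) (h : ∀ y ∈ Y, ∀ y' ∈ Y, θ y = θ y' → y * y'⁻¹ ∈ L) :
    ∃ E : Set G, E.Finite ∧ ∀ y ∈ Y, ∃ k : L, (k : G)⁻¹ * y ∈ E := by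
  classical
  refine ⟨Function.invFunOn θ Y '' (θ '' Y), hfin.image _, fun y hy => ?_⟩
  have hex : ∃ a ∈ Y, θ a = θ y := ⟨y, hy, rfl⟩
  refine ⟨⟨_, h y hy _ (Function.invFunOn_mem hex) (Function.invFunOn_eq hex).symm⟩, θ y,
    ⟨y, hy, rfl⟩, ?_⟩
  simp

end Rips

/-! ### The tree of spaces of a cocompact action. -/

section Hull

variable {V : Type*} {T : SimpleGraph V}

/-- A finite set of vertices of a connected graph is contained in a finite connected one. -/
lemma SimpleGraph.Connected.exists_finite_hull (h : T.Connected) {F₀ : Set V} (hF₀ : F₀.Finite)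
    (o : V) : ∃ F : Set V, F.Finite ∧ F₀ ⊆ F ∧ ∃ L, ∀ u ∈ F, ∀ w ∈ F,
      ∃ p : T.Walk u w, p.length ≤ L ∧ ∀ v ∈ p.support, v ∈ F := by
  classical
  let c : ∀ v, T.Walk o v := fun v => (h.preconnected o v).some
  let F : Set V := ⋃ f ∈ F₀, {v | v ∈ (c f).support}
  have hF : F.Finite := hF₀.biUnion fun f _ => List.finite_toSet _
  have hroot : ∀ u ∈ F, ∃ p : T.Walk o u, ∀ v ∈ p.support, v ∈ F := by
    intro u hu
    obtain ⟨f, hf, hu⟩ := Set.mem_iUnion₂.1 hu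
    exact ⟨(c f).takeUntil u hu, fun v hv =>
      Set.mem_iUnion₂.2 ⟨f, hf, (c f).support_takeUntil_subset_support hu hv⟩⟩
  have hev : ∀ᶠ L in atTop, ∀ q ∈ F ×ˢ F,
      ∃ p : T.Walk q.1 q.2, p.length ≤ L ∧ ∀ v ∈ p.support, v ∈ F := by
    refine (Filter.eventually_all_finite (hF.prod hF)).2 fun q hq => ?_
    obtain ⟨p₁, h₁⟩ := hroot q.1 hq.1
    obtain ⟨p₂, h₂⟩ := hroot q.2 hq.2
    filter_upwards [eventually_ge_atTop (p₁.reverse.append p₂).length] with L hL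
    refine ⟨p₁.reverse.append p₂, hL, fun v hv => ?_⟩
    rw [SimpleGraph.Walk.mem_support_append_iff, SimpleGraph.Walk.support_reverse,
      List.mem_reverse] at hv
    exact hv.elim (h₁ v) (h₂ v)
  obtain ⟨L, hL⟩ := hev.exists
  exact ⟨F, hF, fun f hf => Set.mem_iUnion₂.2 ⟨f, hf, (c f).end_mem_support⟩, L,
    fun u hu w hw => hL (u, w) ⟨hu, hw⟩⟩

end Hull

section Action

variable {G V : Type*} [Group G] [MulAction G V]

/-- The elements of `G` that move some vertex of `F` to `u`. -/
def vertexSpace (G : Type*) [Group G] [MulAction G V] (F : Set V) (u : V) : Set G :=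
  {g | g⁻¹ • u ∈ F}

variable {F : Set V}

lemma mem_vertexSpace_translate (g x : G) (u : V) :
    x ∈ vertexSpace G F u ↔ g * x ∈ vertexSpace G F (g • u) := by
  simp [vertexSpace, mul_smul]

lemma stabilizer_mem_vertexSpace {u : V} (hu : u ∈ F) {g : G} (hg : g ∈ MulAction.stabilizer G u) :
    g ∈ vertexSpace G F u := by
  have h : g⁻¹ • u = u := (inv_mem hg : g⁻¹ ∈ MulAction.stabilizer G u)
  simpa [vertexSpace, h] using hu

lemma edgeStabilizer_mem_vertexSpace {u w : V} (hu : u ∈ F) (hw : w ∈ F) {g : G}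
    (hg : g ∈ edgeStabilizer G u w) : g ∈ vertexSpace G F u ∩ vertexSpace G F w :=
  ⟨stabilizer_mem_vertexSpace hu hg.1, stabilizer_mem_vertexSpace hw hg.2⟩

lemma mul_inv_mem_stabilizer {u : V} {y y' : G} (h : y⁻¹ • u = y'⁻¹ • u) :
    y * y'⁻¹ ∈ MulAction.stabilizer G u := by
  rw [MulAction.mem_stabilizer_iff, mul_smul, ← h, smul_inv_smul]

lemma vertexSpace_representatives (hF : F.Finite) (u : V) :
    ∃ E : Set G, E.Finite ∧ ∀ y ∈ vertexSpace G F u,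
      ∃ k : MulAction.stabilizer G u, (k : G)⁻¹ * y ∈ E :=
  exists_finite_representatives _ _ (fun y => y⁻¹ • u)
    (hF.subset (by rintro _ ⟨y, hy, rfl⟩; exact hy)) fun _ _ _ _ h => mul_inv_mem_stabilizer h

lemma edgeSpace_representatives (hF : F.Finite) (u w : V) :
    ∃ E : Set G, E.Finite ∧ ∀ y ∈ vertexSpace G F u ∩ vertexSpace G F w,
      ∃ k : edgeStabilizer G u w, (k : G)⁻¹ * y ∈ E :=
  exists_finite_representatives _ _ (fun y => (y⁻¹ • u, y⁻¹ • w))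
    ((hF.prod hF).subset (by rintro _ ⟨y, hy, rfl⟩; exact hy)) fun _ _ _ _ h =>
      ⟨mul_inv_mem_stabilizer (congrArg Prod.fst h), mul_inv_mem_stabilizer (congrArg Prod.snd h)⟩

variable {A : Set G}

lemma IsHyperbolicGroup.finite_generators {G : Type*} [Group G] (h : IsHyperbolicGroup G) :
    ∃ S : Set G, S.Finite ∧ Subgroup.closure S = ⊤ := by
  obtain ⟨S, hS, hSf, -⟩ := h
  exact ⟨S, hSf, hS⟩

lemma eventually_vertexSpace (hA : Subgroup.closure A = ⊤) (hf : A.Finite) (hF : F.Finite) {u : V}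
    (hu : u ∈ F) (h : IsHyperbolicGroup (MulAction.stabilizer G u)) :
    ∀ᶠ R in atTop, ((ripsGraph A R).induce (vertexSpace G F u)).Connected ∧
      ∃ δ, FourPoint (ripsDist A R (vertexSpace G F u)) δ := by
  obtain ⟨S, hSf, hS⟩ := h.finite_generators
  obtain ⟨δ, hδ⟩ := h.exists_fourPoint hS hSf
  obtain ⟨E, hE, hE'⟩ := vertexSpace_representatives (G := G) hF u
  filter_upwards [eventually_rips_of_subgroup hA hf hS hSf
    (fun k => stabilizer_mem_vertexSpace hu k.2) hE hE'] with R hR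
  obtain ⟨hcon, C, -, ρ, hρ, -⟩ := hR
  exact ⟨hcon, _, hρ.fourPoint (isGeodesicDist_rips hcon)
    (mulCayley_connected hS).isGeodesicDist hδ⟩

lemma eventually_edgeSpace (hA : Subgroup.closure A = ⊤) (hf : A.Finite) (hF : F.Finite) {u w : V}
    (hu : u ∈ F) (hw : w ∈ F) (h : IsQuasiIsometricEmbedding
      (Subgroup.inclusion (inf_le_left : edgeStabilizer G u w ≤ MulAction.stabilizer G u))) :
    ∀ᶠ R in atTop,
      ((ripsGraph A R).induce (vertexSpace G F u ∩ vertexSpace G F w)).Connected ∧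
      ∃ K, RipsEmbeds A R (vertexSpace G F u ∩ vertexSpace G F w) (vertexSpace G F u) K := by
  obtain ⟨S, S', hSf, hSf', hS, hS', K, hK⟩ := h.exists_isCoarseEmbedding
  obtain ⟨E, hE, hE₁⟩ := edgeSpace_representatives (G := G) hF u w
  obtain ⟨E', hE', hE₂⟩ := vertexSpace_representatives (G := G) hF u
  filter_upwards [eventually_rips_of_subgroup hA hf hS hSf
      (fun k => edgeStabilizer_mem_vertexSpace hu hw k.2) hE hE₁,
    eventually_rips_of_subgroup hA hf hS' hSf'
      (fun k => stabilizer_mem_vertexSpace hu k.2) hE' hE₂] with R h₁ h₂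
  obtain ⟨hcon, C, -, ρ, hρ, hρ'⟩ := h₁
  obtain ⟨hcon', C', hι, -⟩ := h₂
  refine ⟨hcon, ?_⟩
  -- The inclusion of Rips graphs is compared with a detour through the groups: retract the edge
  -- space to the edge group, include in the vertex group, and return to the vertex space. The two
  -- maps are within distance `1`.
  have hcomp := (hι.comp hK).comp hρ
  obtain ⟨D, hD⟩ : ∃ D, D = C * (K * C' + K) + C := ⟨_, rfl⟩
  rw [← hD] at hcomp
  have hd := isGeodesicDist_rips hcon'
  -- The error `1` at both ends turns `D * _ + D` into `D * _ + 3 * D`; the extra `1` makes the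
  -- constant positive for the upper bound.
  refine ⟨3 * D + 1, Set.inter_subset_left, fun x y => ?_, fun x y => ?_⟩
  · have h1 := hcon.lipschitz_of_adj hd (Set.inclusion Set.inter_subset_left) 1
      (fun x y hxy => ripsDist_le_one (rips_adj.1 hxy).2) x y
    exact h1.trans (Nat.mul_le_mul_right _ (by omega))
  · have h1 := hcomp.lower x y
    obtain ⟨g, hg⟩ : ∃ g : (vertexSpace G F u ∩ vertexSpace G F w : Set G) → vertexSpace G F u,
        g = (fun k => ⟨k, stabilizer_mem_vertexSpace hu k.2⟩) ∘
        (Subgroup.inclusion (inf_le_left : edgeStabilizer G u w ≤ MulAction.stabilizer G u)) ∘ ρ :=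
      ⟨_, rfl⟩
    have near : ∀ x, ripsDist A R (vertexSpace G F u) (g x)
        (Set.inclusion Set.inter_subset_left x) ≤ 1 := fun x => by
      rw [hg]; exact ripsDist_le_one (hρ' x)
    have h2 := near x
    have h3 := near y
    have h1' : ripsDist A R (vertexSpace G F u ∩ vertexSpace G F w) x y ≤
      D * ripsDist A R (vertexSpace G F u) (g x) (g y) + D := by rw [hg]; exact h1
    obtain ⟨x', hx'⟩ : ∃ x' : vertexSpace G F u, x' = Set.inclusion Set.inter_subset_left x :=
      ⟨_, rfl⟩
    obtain ⟨y', hy'⟩ : ∃ y' : vertexSpace G F u, y' = Set.inclusion Set.inter_subset_left y :=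
      ⟨_, rfl⟩
    rw [← hx'] at h2 ⊢
    rw [← hy'] at h3 ⊢
    have h4 := hd.triangle (g x) x' (g y)
    have h5 := hd.triangle x' y' (g y)
    have h6 := hd.comm y' (g y)
    have h7 := Nat.mul_le_mul_left D (show ripsDist A R (vertexSpace G F u) (g x) (g y) ≤
      ripsDist A R (vertexSpace G F u) x' y' + 2 by omega)
    nlinarith

/-- The tree of spaces of a cocompact action on a tree. -/
theorem exists_treeOfSpaces (hA : Subgroup.closure A = ⊤) (hf : A.Finite) (T : SimpleGraph V)
    (hT : T.IsTree) (hact : ∀ (g : G) (v w : V), T.Adj v w → T.Adj (g • v) (g • w))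
    (hcocompact : IsCocompactAction G T)
    (hvertex : ∀ v : V, IsHyperbolicGroup (MulAction.stabilizer G v))
    (hqi : ∀ v w : V, T.Adj v w → IsQuasiIsometricEmbedding
      (Subgroup.inclusion (inf_le_left : edgeStabilizer G v w ≤ MulAction.stabilizer G v)))
    (o w : V) : ∃ F : Set V, F.Finite ∧ o ∈ F ∧ w ∈ F ∧ ∀ᶠ R in atTop, ∃ R' δ K,
      TreeOfSpaces T (SimpleGraph.mulCayley A).dist (vertexSpace G F)
        (fun u => ripsDist A R (vertexSpace G F u))
        (fun u w => ripsDist A R (vertexSpace G F u ∩ vertexSpace G F w)) R' δ K := by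
  obtain ⟨F₀, hF₀, hcv, hce⟩ := hcocompact
  -- Including `A • o` makes Cayley neighbours share a vertex space (`cover`), and the walks inside
  -- `F` give `linked`. The vertices `o` and `w` are included so that their stabilizers lie in their
  -- vertex spaces.
  obtain ⟨F, hF, hsub, L, hL⟩ := hT.connected.exists_finite_hull
    (((hF₀.insert w).insert o).union (hf.image (· • o))) o
  have ho : o ∈ F := hsub (by simp)
  have hcv' : ∀ v, ∃ g : G, g • v ∈ F := fun v => (hcv v).imp fun g hg => hsub (by simp [hg])
  have hce' : ∀ v w, T.Adj v w → ∃ g : G, g • v ∈ F ∧ g • w ∈ F := fun v w h =>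
    (hce v w h).imp fun g hg => ⟨hsub (by simp [hg.1]), hsub (by simp [hg.2])⟩
  have hs : ∀ s ∈ A, s • o ∈ F := fun s hs => hsub (Or.inr ⟨s, hs, rfl⟩)
  refine ⟨F, hF, ho, hsub (by simp), ?_⟩
  have hev₁ := (Filter.eventually_all_finite hF).2 fun u hu =>
    eventually_vertexSpace hA hf hF hu (hvertex u)
  have hev₂ : ∀ᶠ R in atTop, ∀ q ∈ F ×ˢ F, T.Adj q.1 q.2 →
      ((ripsGraph A R).induce (vertexSpace G F q.1 ∩ vertexSpace G F q.2)).Connected ∧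
      ∃ K, RipsEmbeds A R (vertexSpace G F q.1 ∩ vertexSpace G F q.2) (vertexSpace G F q.1) K := by
    refine (Filter.eventually_all_finite (hF.prod hF)).2 fun q hq => ?_
    by_cases hadj : T.Adj q.1 q.2
    · exact (eventually_edgeSpace hA hf hF hq.1 hq.2 (hqi _ _ hadj)).mono fun R hR _ => hR
    · exact Eventually.of_forall fun R h => absurd h hadj
  filter_upwards [hev₁, hev₂, eventually_ge_atTop 1] with R h₁ h₂ hR
  -- Uniform constants are needed only on the finite set `F`: every vertex space and every edge
  -- space is a left translate of one over `F`, and translation preserves the Rips metrics.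
  obtain ⟨δ, hδ⟩ : ∃ δ, ∀ u ∈ F, FourPoint (ripsDist A R (vertexSpace G F u)) δ := by
    have : ∀ᶠ δ in atTop, ∀ u ∈ F, FourPoint (ripsDist A R (vertexSpace G F u)) δ := by
      refine (Filter.eventually_all_finite hF).2 fun u hu => ?_
      obtain ⟨-, δ, hδ⟩ := h₁ u hu
      exact (eventually_ge_atTop δ).mono fun _ h => hδ.mono h
    exact this.exists
  obtain ⟨K, hK⟩ : ∃ K, ∀ q ∈ F ×ˢ F, T.Adj q.1 q.2 → RipsEmbeds A R
      (vertexSpace G F q.1 ∩ vertexSpace G F q.2) (vertexSpace G F q.1) K := by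
    have : ∀ᶠ K in atTop, ∀ q ∈ F ×ˢ F, T.Adj q.1 q.2 → RipsEmbeds A R
        (vertexSpace G F q.1 ∩ vertexSpace G F q.2) (vertexSpace G F q.1) K := by
      refine (Filter.eventually_all_finite (hF.prod hF)).2 fun q hq => ?_
      by_cases hadj : T.Adj q.1 q.2
      · obtain ⟨-, K, h, hK⟩ := h₂ q hq hadj
        exact (eventually_ge_atTop K).mono fun _ hle _ => ⟨h, hK.mono hle⟩
      · exact Eventually.of_forall fun K h => absurd h hadj
    exact this.exists
  have mem_inter : ∀ (g : G) (u w : V) (x : G), x ∈ vertexSpace G F u ∩ vertexSpace G F w ↔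
      g * x ∈ vertexSpace G F (g • u) ∩ vertexSpace G F (g • w) := fun g u w x =>
    and_congr (mem_vertexSpace_translate g x u) (mem_vertexSpace_translate g x w)
  have hcon : ∀ u, ((ripsGraph A R).induce (vertexSpace G F u)).Connected := fun u => by
    obtain ⟨g, hg⟩ := hcv' u
    exact rips_connected_translate hA g (fun x => mem_vertexSpace_translate g x u) (h₁ _ hg).1
  have hcon' : ∀ u w, T.Adj u w →
      ((ripsGraph A R).induce (vertexSpace G F u ∩ vertexSpace G F w)).Connected := by
    intro u w huw
    obtain ⟨g, hg⟩ := hce' u w huw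
    exact rips_connected_translate hA g (mem_inter g u w)
      (h₂ (_, _) ⟨hg.1, hg.2⟩ (hact g u w huw)).1
  have hemb : ∀ u w, T.Adj u w →
      RipsEmbeds A R (vertexSpace G F u ∩ vertexSpace G F w) (vertexSpace G F u) K := by
    intro u w huw
    obtain ⟨g, hg⟩ := hce' u w huw
    exact ripsEmbeds_translate hA g (mem_inter g u w) (fun x => mem_vertexSpace_translate g x u)
      (hcon' _ _ (hact g u w huw)) (hcon _) (hK (_, _) ⟨hg.1, hg.2⟩ (hact g u w huw))
  refine ⟨max R L, δ, K, ?_⟩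
  refine
    { vertex_geodesic := fun v => isGeodesicDist_rips (hcon v)
      vertex_fourPoint := fun u => ?_
      dist_le := fun v x y => (dist_le_ripsDist hA (hcon v) x y).trans
        (Nat.mul_le_mul_right _ (le_max_left _ _))
      edge_nonempty := fun u w huw => ?_
      edge_geodesic := fun u w huw => isGeodesicDist_rips (hcon' u w huw)
      edge_left := fun u w huw => (hemb u w huw).2
      edge_right := fun u w huw => ?_
      linked := fun x u w hu hw => ?_
      cover := fun x y hxy => ?_ }
  · obtain ⟨g, hg⟩ := hcv' u
    exact fourPoint_translate hA g (fun x => mem_vertexSpace_translate g x u) (hcon _) (hδ _ hg)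
  · obtain ⟨g, hg⟩ := hce' u w huw
    exact ⟨g⁻¹, by simpa [vertexSpace] using hg⟩
  · have h := hemb w u huw.symm
    rw [Set.inter_comm] at h
    exact h.2
  -- A walk inside `F` from `x⁻¹ • u` to `x⁻¹ • w`, translated by `x`, stays among the vertices
  -- whose spaces contain `x`.
  · obtain ⟨p, hp, hp'⟩ := hL _ hu _ hw
    let φ : T →g T := ⟨fun v => x • v, fun h => hact x _ _ h⟩
    refine ⟨(p.map φ).copy (smul_inv_smul x u) (smul_inv_smul x w), ?_, ?_⟩
    · rw [SimpleGraph.Walk.length_copy, SimpleGraph.Walk.length_map]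
      exact hp.trans (le_max_right _ _)
    · intro v hv
      rw [SimpleGraph.Walk.support_copy, SimpleGraph.Walk.support_map, List.mem_map] at hv
      obtain ⟨v', hv', rfl⟩ := hv
      have : x⁻¹ • x • v' ∈ F := by rw [inv_smul_smul]; exact hp' v' hv'
      exact this
  · have mem : ∀ {x y : G}, x⁻¹ * y ∈ A → x ∈ vertexSpace G F (y • o) ∧
        y ∈ vertexSpace G F (y • o) := fun {x y} h => by
      refine ⟨?_, ?_⟩
      · have := hs _ h
        rwa [mul_smul] at this
      · simpa [vertexSpace] using ho
    have hex : ∃ v, x ∈ vertexSpace G F v ∧ y ∈ vertexSpace G F v := by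
      by_cases hxy' : x = y
      · subst hxy'
        exact ⟨x • o, by simpa [vertexSpace] using ho, by simpa [vertexSpace] using ho⟩
      · have h0 := (mulCayley_connected hA).pos_dist_of_ne hxy'
        have h1 : (SimpleGraph.mulCayley A).dist x y = 1 := by omega
        rw [SimpleGraph.dist_eq_one_iff_adj, SimpleGraph.mulCayley_adj] at h1
        rcases h1.2 with h | h
        · exact ⟨_, mem h⟩
        · exact ⟨_, (mem h).symm⟩
    obtain ⟨v, hx, hy⟩ := hex
    exact ⟨v, hx, hy, ripsDist_le_one (hxy.trans hR)⟩

/-- A subgroup that is quasi-isometrically embedded in the vertex space of the root preserves large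
Gromov products. -/
lemma TreeOfSpaces.preservesLargeProducts (hA : Subgroup.closure A = ⊤) (hf : A.Finite)
    {T : SimpleGraph V} (hT : T.IsTree) {R R' δ K δ' : ℕ}
    (t : TreeOfSpaces T (SimpleGraph.mulCayley A).dist (vertexSpace G F)
        (fun u => ripsDist A R (vertexSpace G F u))
        (fun u w => ripsDist A R (vertexSpace G F u ∩ vertexSpace G F w)) R' δ K)
    (hδ' : FourPoint (SimpleGraph.mulCayley A).dist δ') {o : V} {H : Subgroup G} {S : Set H}
    (hS : Subgroup.closure S = ⊤) (hSA : ∀ s ∈ S, (s : G) ∈ A)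
    (hmem : ∀ h : H, (h : G) ∈ vertexSpace G F o) {C : ℕ}
    (hC : IsCoarseEmbedding (SimpleGraph.mulCayley S).dist (ripsDist A R (vertexSpace G F o))
      (fun h => ⟨h, hmem h⟩) C) :
    GeometricRealization.PreservesLargeProducts (cayleyHom hSA) 1 := by
  intro M
  obtain ⟨N, hN⟩ := t.gromov_product_large (mulCayley_connected hA).isGeodesicDist hT hδ'
    -- Properness of the vertex space in `G` holds because word balls of `G` are finite.
    (o := o) ⟨(1 : H), hmem 1⟩ (fun n => by
      have hfin : {x : vertexSpace G F o |
          (SimpleGraph.mulCayley A).dist ((1 : H) : G) x ≤ n}.Finite :=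
        (cayley_finite_ball hA hf n).preimage Subtype.val_injective.injOn
      obtain ⟨m, hm⟩ := hfin.exists_nat_bound fun x =>
        ripsDist A R (vertexSpace G F o) ⟨(1 : H), hmem 1⟩ x
      exact ⟨m, hm⟩) M
  obtain ⟨N', hN'⟩ := hC.large_products (mulCayley_connected hS).isGeodesicDist
    (t.vertex_geodesic o) (t.vertex_fourPoint o) 1 N
  exact ⟨N', fun x y hxy => hN ⟨x, hmem x⟩ ⟨y, hmem y⟩ (hN' x y hxy)⟩

end Action

theorem corollary3p9 {G V : Type*} [Group G] [MulAction G V] (T : SimpleGraph V) (hT : T.IsTree)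
    (hact : ∀ (g : G) (v w : V), T.Adj v w → T.Adj (g • v) (g • w))
    (hcocompact : IsCocompactAction G T)
    (hG : IsHyperbolicGroup G)
    (hvertex : ∀ v : V, IsHyperbolicGroup (MulAction.stabilizer G v))
    (hedge : ∀ v w : V, T.Adj v w → IsHyperbolicGroup (edgeStabilizer G v w))
    (hqi : ∀ v w : V, T.Adj v w → IsQuasiIsometricEmbedding
      (Subgroup.inclusion (inf_le_left : edgeStabilizer G v w ≤ MulAction.stabilizer G v)))
    (H : Subgroup G)
    (hH : (∃ v : V, H = MulAction.stabilizer G v) ∨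
      ∃ v w : V, T.Adj v w ∧ H = edgeStabilizer G v w) :
    HasCannonThurstonMap H := by
  intro S A hS hA hSA hSf hAf
  obtain ⟨δ', hδ'⟩ := hG.exists_fourPoint hA hAf
  have key : GeometricRealization.PreservesLargeProducts (cayleyHom hSA) 1 := by
    rcases hH with ⟨v, rfl⟩ | ⟨v, w, hvw, rfl⟩
    · obtain ⟨F, hF, hv, -, hev⟩ := exists_treeOfSpaces hA hAf T hT hact hcocompact hvertex hqi v v
      obtain ⟨E, hE, hE'⟩ := vertexSpace_representatives (G := G) hF v
      obtain ⟨R, ⟨R', δ, K, t⟩, -, C, hC, -⟩ := (hev.and (eventually_rips_of_subgroup hA hAf hS hSf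
        (fun k => stabilizer_mem_vertexSpace hv k.2) hE hE')).exists
      exact t.preservesLargeProducts hA hAf hT hδ' hS hSA _ hC
    · obtain ⟨F, hF, hv, hw, hev⟩ := exists_treeOfSpaces hA hAf T hT hact hcocompact hvertex hqi v w
      obtain ⟨E, hE, hE'⟩ := edgeSpace_representatives (G := G) hF v w
      obtain ⟨R, ⟨R', δ, K, t⟩, -, C, hC, -⟩ := (hev.and (eventually_rips_of_subgroup hA hAf hS hSf
        (fun k => edgeStabilizer_mem_vertexSpace hv hw k.2) hE hE')).exists
      -- The edge group is treated inside the vertex space of `v`: its Cayley graph embeds coarsely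
      -- in the edge space, which embeds coarsely in that vertex space.
      exact t.preservesLargeProducts hA hAf hT hδ' hS hSA
        (fun k => (edgeStabilizer_mem_vertexSpace hv hw k.2).1) ((t.edge_left v w hvw).comp hC)
  exact key.exists_continuous_extension (mulCayley_connected hS) (mulCayley_connected hA) hδ'
    (cayley_finite_ball hA hAf)
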